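/- Let $Z=|0\rangle\langle 0|-|1\rangle\langle 1|$ and let $X,Y,Z$ be the Pauli matrices. For a Hermitian operator $h$ on $\mathbb C^2\otimes\mathbb C^2$ and $L\ge 2$ let $H_L(h)=\sum_{i=1}^{L-1}h_{i,i+1}$ be the open chain on $L$ qubits, where $h_{i,i+1}$ acts as $h$ on sites $i,i+1$. The spectral gap of a Hermitian operator is the difference of its two lowest distinct eigenvalues. The dimer term $h$ is called gapped if the spectral gap of $H_L(h)$ is bounded below, for all $L\ge2$, by a positive constant independent of $L$, and gapless if this gap tends to $0$ as $L\to\infty$. The chain is frustration-free if each of its ground states is a ground state of every $h_{i,i+1}$. Let $\psi=a|00\rangle+b|01\rangle+c|10\rangle+d|11\rangle$ be a unit vector and $h_\psi=|\psi\rangle\langle\psi|$. 1. (Parity.) For every $L\ge 2$ the following are equivalent: $[H_L(h_\psi),Z^{\otimes L}]=0$; $[(h_\psi)_{i,i+1},Z_iZ_{i+1}]=0$ for all $i$; $[h_\psi,Z\otimes Z]=0$; $\psi$ lies in the even sector $\mathrm{span}\{|00\rangle,|11\rangle\}$ or in the odd sector $\mathrm{span}\{|01\rangle,|10\rangle\}$.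 2. (Ground space.) If $\psi$ is entangled (not a product vector), then for every $L\ge2$ the chain $H_L(h_\psi)$ is frustration-free with ground energy $0$, and its ground space has dimension $L+1$. 3. (Even sector.) If $\psi$ is entangled and even, then $h_\psi$ is gapless. 4. (Odd sector.) Let $\psi$ be entangled and odd. If $|b|=|c|$ then $h_\psi$ is gapless. If $|b|\ne|c|$ then $h_\psi$ is gapped. In the latter case, let $\theta\in(0,\pi/2)$ be defined by $\cos(\theta/2)=\max(|b|,|c|)$, and put $$h(\theta)=\cos\theta\,(Z_i-Z_{i+1})+\sin\theta\,(X_iX_{i+1}+Y_iY_{i+1})-Z_iZ_{i+1}.$$ Then for every $L\ge2$ there is a unitary $U$ on $L$ qubits that commutes with $Z^{\otimes L}$ and satisfies $$U\,H_L(h_\psi)\,U^\dagger=\tfrac14\big[(L-1)\mathbb 1+H_L(h(\theta))\big].$$ If $|b|>|c|$, $U$ can be taken to be a product $\bigotimes_k S_k$ of single-qubit unitaries commuting with $Z$, with $U(h_\psi)_{i,i+1}U^\dagger=\frac14(\mathbb 1+h(\theta)_{i,i+1})$ for every $i$. If $|b|<|c|$, $U$ can be taken to be such a product followed by the reflection $k\mapsto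 L+1-k$ of the chain, with $U(h_\psi)_{i,i+1}U^\dagger=\frac14(\mathbb 1+h(\theta)_{L-i,L-i+1})$ for every $i$. 5. (The family.) For every $\theta\in(0,\pi/2)$, the vector $\psi_\theta=\cos\frac\theta2|01\rangle+\sin\frac\theta2|10\rangle$ is an odd entangled unit vector with $|\psi_\theta\rangle\langle\psi_\theta|=\frac14(\mathbb 1+h(\theta))$. The dimer term $h(\theta)$ is gapped. For every $L\ge2$ the chain $H_L(h(\theta))$ commutes with $Z^{\otimes L}$ and is frustration-free with ground energy $-(L-1)$, and its ground space has dimension $L+1$. -/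

import Mathlib

open scoped Kronecker

noncomputable section

namespace QubitChain

/-- Operators on a single qubit, in the computational basis `|0⟩, |1⟩`. -/
abbrev QubitOp := Matrix (Fin 2) (Fin 2) ℂ

/-- Operators on two qubits; `(x, y)` labels the basis vector `|xy⟩`. -/
abbrev DimerOp := Matrix (Fin 2 × Fin 2) (Fin 2 × Fin 2) ℂ

/-- Operators on `L` qubits; `s : Fin L → Fin 2` labels the basis vector `|s₀ s₁ … ⟩`. -/
abbrev ChainOp (L : ℕ) := Matrix (Fin L → Fin 2) (Fin L → Fin 2) ℂ

def pauliX : QubitOp := !![0, 1; 1, 0]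

def pauliY : QubitOp := !![0, -Complex.I; Complex.I, 0]

def pauliZ : QubitOp := !![1, 0; 0, -1]

/-! ### Two-qubit states -/

/-- The two-qubit basis vector `|xy⟩`. -/
def ket (x y : Fin 2) : Fin 2 × Fin 2 → ℂ := Pi.single (x, y) 1

/-- `ψ` is a unit vector. -/
def IsUnitState (ψ : Fin 2 × Fin 2 → ℂ) : Prop := ∑ x, ‖ψ x‖ ^ 2 = 1

/-- `ψ` is not a product vector `u ⊗ v`. -/
def IsEntangled (ψ : Fin 2 × Fin 2 → ℂ) : Prop :=
  ¬ ∃ u v : Fin 2 → ℂ, ∀ x y, ψ (x, y) = u x * v y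

/-- The even parity sector `span {|00⟩, |11⟩}`. -/
def evenSector : Submodule ℂ (Fin 2 × Fin 2 → ℂ) := Submodule.span ℂ {ket 0 0, ket 1 1}

/-- The odd parity sector `span {|01⟩, |10⟩}`. -/
def oddSector : Submodule ℂ (Fin 2 × Fin 2 → ℂ) := Submodule.span ℂ {ket 0 1, ket 1 0}

/-- The operator `|ψ⟩⟨ψ|`. -/
def proj (ψ : Fin 2 × Fin 2 → ℂ) : DimerOp := Matrix.vecMulVec ψ (star ψ)

/-! ### Operators on a chain of `L` qubits -/

/-- The tensor product `A₀ ⊗ A₁ ⊗ ⋯ ⊗ A_{L-1}` of single-qubit operators. -/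
def tensorOp {L : ℕ} (A : Fin L → QubitOp) : ChainOp L :=
  Matrix.of fun s t => ∏ k, A k (s k) (t k)

/-- The parity operator `Z ⊗ Z ⊗ ⋯ ⊗ Z`. -/
def parity (L : ℕ) : ChainOp L := tensorOp fun _ => pauliZ

/-- The two-qubit operator `h` acting on sites `j` (first tensor factor) and `k` (second tensor
factor) of the chain, and as the identity on all other sites. It is used for `j ≠ k` only. -/
def dimerAt {L : ℕ} (h : DimerOp) (j k : Fin L) : ChainOp L :=
  Matrix.of fun s t =>
    if ∀ m, m ≠ j → m ≠ k → s m = t m then h (s j, s k) (t j, t k) else 0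

/-- The two-qubit operator `h` acting on the nearest neighbours `i` and `i + 1` of the chain. -/
def bond {L : ℕ} (h : DimerOp) (i : Fin (L - 1)) : ChainOp L :=
  dimerAt h ⟨i.val, by omega⟩ ⟨i.val + 1, by omega⟩

/-- The open-boundary, translation-invariant chain Hamiltonian `∑ᵢ h_{i,i+1}`. -/
def chain (h : DimerOp) (L : ℕ) : ChainOp L := ∑ i : Fin (L - 1), bond h i

/-- The unitary that reverses the order of the sites. -/
def reflection (L : ℕ) : ChainOp L :=
  Matrix.of fun s t => if ∀ k, s k = t k.rev then 1 else 0

/-! ### Spectral notions -/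

/-- The real eigenvalues of `H` (all eigenvalues, when `H` is Hermitian). -/
def energies {L : ℕ} (H : ChainOp L) : Set ℝ :=
  {E | Module.End.HasEigenvalue (Matrix.toLin' H) (E : ℂ)}

/-- `E` is the lowest eigenvalue of `H`. -/
def IsGroundEnergy {L : ℕ} (H : ChainOp L) (E : ℝ) : Prop := IsLeast (energies H) E

/-- The eigenspace of `H` for the eigenvalue `E`. -/
def energySpace {L : ℕ} (H : ChainOp L) (E : ℝ) : Submodule ℂ ((Fin L → Fin 2) → ℂ) :=
  Module.End.eigenspace (Matrix.toLin' H) (E : ℂ)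

/-- `γ` is the difference between the two lowest distinct eigenvalues of `H`. -/
def IsSpectralGap {L : ℕ} (H : ChainOp L) (γ : ℝ) : Prop :=
  ∃ E₀ E₁ : ℝ, IsGroundEnergy H E₀ ∧ IsLeast {E | E ∈ energies H ∧ E₀ < E} E₁ ∧ γ = E₁ - E₀

/-- The chains with dimer term `h` are gapped: the spectral gap exists for every length `L ≥ 2` and
is bounded below by a positive constant that does not depend on `L`. -/
def Gapped (h : DimerOp) : Prop :=
  ∃ c : ℝ, 0 < c ∧ ∀ L : ℕ, 2 ≤ L → ∃ γ : ℝ, IsSpectralGap (chain h L) γ ∧ c ≤ γ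

/-- The chains with dimer term `h` are gapless: the spectral gap tends to zero as `L → ∞`. -/
def Gapless (h : DimerOp) : Prop :=
  ∀ ε : ℝ, 0 < ε → ∃ L₀ : ℕ, ∀ L : ℕ, L₀ ≤ L → ∃ γ : ℝ, IsSpectralGap (chain h L) γ ∧ γ < ε

/-- Every ground state of the chain is a ground state of each of its dimer terms. -/
def IsFrustrationFree (h : DimerOp) (L : ℕ) : Prop :=
  ∀ E : ℝ, IsGroundEnergy (chain h L) E → ∀ i : Fin (L - 1),
    ∃ e : ℝ, IsGroundEnergy (bond h i : ChainOp L) e ∧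
      energySpace (chain h L) E ≤ energySpace (bond h i) e

/-! ### The one-parameter family -/

/-- `cos θ (Z ⊗ 1 - 1 ⊗ Z) + sin θ (X ⊗ X + Y ⊗ Y) - Z ⊗ Z`. -/
def hTheta (θ : ℝ) : DimerOp :=
  (Real.cos θ : ℂ) • (pauliZ ⊗ₖ (1 : QubitOp) - (1 : QubitOp) ⊗ₖ pauliZ) +
    (Real.sin θ : ℂ) • (pauliX ⊗ₖ pauliX + pauliY ⊗ₖ pauliY) - pauliZ ⊗ₖ pauliZ

/-- `cos (θ/2) |01⟩ + sin (θ/2) |10⟩`. -/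
def psiTheta (θ : ℝ) : Fin 2 × Fin 2 → ℂ :=
  (Real.cos (θ / 2) : ℂ) • ket 0 1 + (Real.sin (θ / 2) : ℂ) • ket 1 0

end QubitChain

end

noncomputable section

namespace QubitChain

open Matrix Function
open scoped ComplexOrder

variable {L : ℕ}

/-! ### Dimer and product operators -/

/-! Parity. Compare two configurations differing by a flip at an end site. Only the end bond
connects them, so commutation with the parity forces a product of two amplitudes of `ψ` to vanish.
The two ends together give `mem_sector_of_commute`.

Ground space. The functional `⟨ψ|` is the singlet functional composed with `1 ⊗ G`, where `G` is
invertible because `ψ` is entangled. The product operator `⨂ₖ G ^ k` turns every bond constraint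
into invariance under an adjacent transposition (`bond_mulVec_eq_zero_iff`). The zero-energy vectors
thus correspond to functions of the content of a configuration, a space of dimension `L + 1`
(`finrank_energySpace_chain`).

Gap. For odd `ψ` the dimer projections satisfy `p q p = t² p` on neighbouring bonds, with `t =
|b||c|`, and commute on distant ones. Completing squares gives `H² ≥ (1 - 2t) H`
(`posSemidef_sq_sum_projections`), and `1 - 2t = (|b| - |c|)²` is positive when the moduli differ.

Gaplessness. Over a suitable reference configuration, single flips span an invariant space. A trial
vector `v` there has `⟨v, Hv⟩ = L - 1`, while `Hv` telescopes to two end terms with `‖Hv‖² ≤ 2`.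
Since `H² ≥ γ H` for the gap `γ`, it is at most of order `1 / L` (`gapless_of_hopping`).

Normal form. Phase gates with linearly growing exponents remove the phases of an odd `ψ` on all
bonds at once, and a reflection exchanges its two amplitudes if necessary (`exists_unitary_odd`). -/

lemma dimerAt_mulVec (h : DimerOp) {j k : Fin L} (hjk : j ≠ k) (v : (Fin L → Fin 2) → ℂ)
    (s : Fin L → Fin 2) :
    (dimerAt h j k *ᵥ v) s =
      ∑ p : Fin 2 × Fin 2, h (s j, s k) p * v (update (update s j p.1) k p.2) := by
  symm
  refine Finset.sum_of_injOn (fun p => update (update s j p.1) k p.2) ?_ (by simp) ?_ ?_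
  · intro p _ q _ hpq
    have h1 := congrFun hpq j
    have h2 := congrFun hpq k
    simp [hjk] at h1 h2
    exact Prod.ext h1 h2
  · intro t _ ht
    simp only [dimerAt, of_apply]
    rw [if_neg, zero_mul]
    intro hst
    refine ht ⟨(t j, t k), by simp, ?_⟩
    funext m
    by_cases hk : m = k
    · subst hk; simp
    by_cases hj : m = j
    · subst hj; simp [hk]
    simp [hk, hj, hst m hj hk]
  · intro p _
    simp only [dimerAt, of_apply]
    rw [if_pos (by intro m hj hk; simp [hj, hk])]
    simp [hjk]

lemma ext_mulVec {n : Type*} [Fintype n] {A B : Matrix n n ℂ} (h : ∀ v, A *ᵥ v = B *ᵥ v) : A = B :=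
  mulVec_injective (funext h)

lemma dimerAt_mul (g h : DimerOp) {j k : Fin L} (hjk : j ≠ k) :
    dimerAt g j k * dimerAt h j k = dimerAt (g * h) j k := by
  refine ext_mulVec fun v => funext fun s => ?_
  rw [← mulVec_mulVec, dimerAt_mulVec _ hjk, dimerAt_mulVec _ hjk]
  simp only [dimerAt_mulVec _ hjk, update_self, update_of_ne hjk, Matrix.mul_apply,
    Finset.sum_mul, Finset.mul_sum]
  rw [Finset.sum_comm]
  refine Finset.sum_congr rfl fun p _ => Finset.sum_congr rfl fun q _ => ?_
  have : update (update (update (update s j q.1) k q.2) j p.1) k p.2 =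
      update (update s j p.1) k p.2 := by
    funext m
    by_cases hk : m = k
    · subst hk; simp
    by_cases hj : m = j
    · subst hj; simp [hk]
    simp [hk, hj]
  rw [this, mul_assoc]

lemma dimerAt_one (j k : Fin L) : dimerAt 1 j k = (1 : ChainOp L) := by
  ext s t
  simp only [dimerAt, of_apply, one_apply]
  by_cases hst : s = t
  · subst hst; simp
  · rw [if_neg hst]
    split_ifs with h1 h2
    · refine absurd (funext fun m => ?_) hst
      rw [Prod.mk.injEq] at h2
      by_cases hj : m = j
      · rw [hj, h2.1]
      by_cases hk : m = k
      · rw [hk, h2.2]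
      exact h1 m hj hk
    · rfl
    · rfl

lemma dimerAt_add (g h : DimerOp) (j k : Fin L) :
    dimerAt (g + h) j k = dimerAt g j k + dimerAt h j k := by
  ext s t; simp only [dimerAt, of_apply, Matrix.add_apply]; split_ifs <;> simp

lemma dimerAt_smul (c : ℂ) (h : DimerOp) (j k : Fin L) :
    dimerAt (c • h) j k = c • dimerAt h j k := by
  ext s t; simp only [dimerAt, of_apply, Matrix.smul_apply]; split_ifs <;> simp

lemma dimerAt_conjTranspose (h : DimerOp) (j k : Fin L) :
    (dimerAt h j k)ᴴ = dimerAt hᴴ j k := by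
  ext s t
  simp only [dimerAt, of_apply, conjTranspose_apply]
  by_cases hc : ∀ m, m ≠ j → m ≠ k → s m = t m
  · rw [if_pos hc, if_pos fun m hj hk => (hc m hj hk).symm]
  · rw [if_neg hc, if_neg fun hc' => hc fun m hj hk => (hc' m hj hk).symm, star_zero]

lemma dimerAt_injective {j k : Fin L} (hjk : j ≠ k) :
    Injective fun h : DimerOp => dimerAt h j k := by
  intro g h hgh
  ext ⟨x, y⟩ ⟨z, w⟩
  have := congrFun (congrFun hgh (update (update 0 j x) k y)) (update (update 0 j z) k w)
  simp only [dimerAt, of_apply] at this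
  rw [if_pos (by intro m hj hk; simp [hj, hk]), if_pos (by intro m hj hk; simp [hj, hk])] at this
  simpa [hjk] using this

/-- Dimer terms on disjoint pairs of sites commute. -/
lemma dimerAt_commute (g h : DimerOp) {j k l m : Fin L} (hjk : j ≠ k) (hlm : l ≠ m)
    (hjl : j ≠ l) (hjm : j ≠ m) (hkl : k ≠ l) (hkm : k ≠ m) :
    Commute (dimerAt g j k) (dimerAt h l m) := by
  refine ext_mulVec fun v => funext fun s => ?_
  rw [← mulVec_mulVec, ← mulVec_mulVec, dimerAt_mulVec _ hjk, dimerAt_mulVec _ hlm]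
  simp only [dimerAt_mulVec _ hjk, dimerAt_mulVec _ hlm, Finset.mul_sum]
  rw [Finset.sum_comm]
  refine Finset.sum_congr rfl fun p _ => Finset.sum_congr rfl fun q _ => ?_
  rw [update_comm hkl, update_comm hjl, update_comm hkm, update_comm hjm]
  simp [hjl, hjm, hkl, hkm, hjl.symm, hjm.symm, hkl.symm, hkm.symm]
  ring

lemma dimerAt_swap (h : DimerOp) (j k : Fin L) :
    dimerAt (h.submatrix Prod.swap Prod.swap) j k = dimerAt h k j := by
  ext s t
  simp only [dimerAt, of_apply, submatrix_apply, Prod.swap_prod_mk]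
  congr 1
  exact propext ⟨fun H m a b => H m b a, fun H m a b => H m b a⟩

lemma prod_eq_mul_mul_prod {j k : Fin L} (hjk : j ≠ k) (F : Fin L → ℂ) :
    ∏ m, F m = F j * F k * ∏ m ∈ ({j, k} : Finset (Fin L))ᶜ, F m := by
  rw [← Finset.prod_mul_prod_compl {j, k}, Finset.prod_pair hjk]

/-- A product operator carries a dimer term to the transformed dimer term. -/
lemma tensorOp_mul_dimerAt (A : Fin L → QubitOp) {g h : DimerOp} {j k : Fin L} (hjk : j ≠ k)
    (H : (A j ⊗ₖ A k) * h = g * (A j ⊗ₖ A k)) :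
    tensorOp A * dimerAt h j k = dimerAt g j k * tensorOp A := by
  have hc (u v : Fin L → Fin 2) (p : Fin 2 × Fin 2) :
      ∏ m ∈ ({j, k} : Finset (Fin L))ᶜ, A m (u m) (update (update v j p.1) k p.2 m) =
        ∏ m ∈ ({j, k} : Finset (Fin L))ᶜ, A m (u m) (v m) := by
    refine Finset.prod_congr rfl fun m hm => ?_
    simp only [Finset.mem_compl, Finset.mem_insert, Finset.mem_singleton, not_or] at hm
    simp [hm.1, hm.2]
  have hc' (u v : Fin L → Fin 2) (p : Fin 2 × Fin 2) :
      ∏ m ∈ ({j, k} : Finset (Fin L))ᶜ, A m (update (update v j p.1) k p.2 m) (u m) =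
        ∏ m ∈ ({j, k} : Finset (Fin L))ᶜ, A m (v m) (u m) := by
    refine Finset.prod_congr rfl fun m hm => ?_
    simp only [Finset.mem_compl, Finset.mem_insert, Finset.mem_singleton, not_or] at hm
    simp [hm.1, hm.2]
  ext s t
  have e1 : (tensorOp A * dimerAt h j k) s t =
      ((A j ⊗ₖ A k) * h) (s j, s k) (t j, t k) *
        ∏ m ∈ ({j, k} : Finset (Fin L))ᶜ, A m (s m) (t m) := by
    -- Right multiplication by a dimer term is its transpose acting on a row, so `dimerAt_mulVec`
    -- evaluates both products.
    have : (tensorOp A * dimerAt h j k) s t = (dimerAt hᵀ j k *ᵥ fun u => tensorOp A s u) t := by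
      simp only [Matrix.mul_apply, mulVec, dotProduct]
      refine Finset.sum_congr rfl fun u _ => ?_
      rw [mul_comm]
      congr 1
      simp only [dimerAt, of_apply, transpose_apply]
      congr 1
      exact propext ⟨fun H m a b => (H m a b).symm, fun H m a b => (H m a b).symm⟩
    rw [this, dimerAt_mulVec _ hjk, Matrix.mul_apply, Finset.sum_mul]
    refine Finset.sum_congr rfl fun p _ => ?_
    simp only [tensorOp, of_apply]
    rw [prod_eq_mul_mul_prod hjk, hc]
    simp [hjk]
    ring
  have e2 : (dimerAt g j k * tensorOp A) s t =
      (g * (A j ⊗ₖ A k)) (s j, s k) (t j, t k) *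
        ∏ m ∈ ({j, k} : Finset (Fin L))ᶜ, A m (s m) (t m) := by
    have : (dimerAt g j k * tensorOp A) s t = (dimerAt g j k *ᵥ fun u => tensorOp A u t) s := rfl
    rw [this, dimerAt_mulVec _ hjk, Matrix.mul_apply, Finset.sum_mul]
    refine Finset.sum_congr rfl fun p _ => ?_
    simp only [tensorOp, of_apply]
    rw [prod_eq_mul_mul_prod hjk, hc']
    simp [hjk]
    ring
  rw [e1, e2, H]

lemma tensorOp_mul (A B : Fin L → QubitOp) :
    tensorOp A * tensorOp B = tensorOp fun k => A k * B k := by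
  ext s t
  simp only [tensorOp, of_apply, Matrix.mul_apply, Finset.prod_univ_sum, Fintype.piFinset_univ,
    ← Finset.prod_mul_distrib]

lemma tensorOp_one : tensorOp (fun _ : Fin L => (1 : QubitOp)) = 1 := by
  ext s t
  simp only [tensorOp, of_apply, one_apply, Finset.prod_ite_zero, Finset.prod_const_one]
  simp [funext_iff]

lemma tensorOp_conjTranspose (A : Fin L → QubitOp) :
    (tensorOp A)ᴴ = tensorOp fun k => (A k)ᴴ := by
  ext s t; simp [tensorOp]

lemma tensorOp_mem_unitaryGroup {A : Fin L → QubitOp} (hA : ∀ k, A k ∈ unitaryGroup (Fin 2) ℂ) :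
    tensorOp A ∈ unitaryGroup (Fin L → Fin 2) ℂ := by
  rw [mem_unitaryGroup_iff, star_eq_conjTranspose, tensorOp_conjTranspose, tensorOp_mul]
  simp only [← star_eq_conjTranspose, fun k => mem_unitaryGroup_iff.1 (hA k), tensorOp_one]

lemma tensorOp_commute {A B : Fin L → QubitOp} (h : ∀ k, Commute (A k) (B k)) :
    Commute (tensorOp A) (tensorOp B) := by
  rw [commute_iff_eq, tensorOp_mul, tensorOp_mul]
  simp only [fun k => (h k).eq]

/-! ### Energies of positive semidefinite Hamiltonians -/

lemma mem_energySpace {H : ChainOp L} {E : ℝ} {v : (Fin L → Fin 2) → ℂ} :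
    v ∈ energySpace H E ↔ H *ᵥ v = (E : ℂ) • v := by
  simp [energySpace]

lemma mem_energies_iff {H : ChainOp L} {E : ℝ} :
    E ∈ energies H ↔ ∃ v, v ≠ 0 ∧ H *ᵥ v = (E : ℂ) • v := by
  constructor
  · intro h
    obtain ⟨v, hv⟩ := Module.End.HasEigenvalue.exists_hasEigenvector h
    exact ⟨v, hv.2, by simpa using hv.apply_eq_smul⟩
  · rintro ⟨v, hv0, hv⟩
    exact Module.End.hasEigenvalue_of_hasEigenvector (x := v)
      ⟨by simpa [Module.End.mem_eigenspace_iff] using hv, hv0⟩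

lemma finite_energies (H : ChainOp L) : (energies H).Finite :=
  (Module.End.finite_hasEigenvalue (Matrix.toLin' H)).preimage
    (Complex.ofReal_injective.injOn)

lemma nonneg_of_mul_star_dotProduct_self {n : Type*} [Fintype n] {v : n → ℂ} (hv : v ≠ 0) {c : ℝ}
    (h : 0 ≤ (c : ℂ) * (star v ⬝ᵥ v)) : 0 ≤ c := by
  have h1 := (Complex.lt_def.1 (dotProduct_star_self_pos_iff.2 hv)).1
  have h2 := (Complex.le_def.1 h).1
  rw [Complex.re_ofReal_mul] at h2
  exact nonneg_of_mul_nonneg_left h2 h1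

lemma nonneg_of_mem_energies {H : ChainOp L} (hH : H.PosSemidef) {E : ℝ} (hE : E ∈ energies H) :
    0 ≤ E := by
  obtain ⟨v, hv0, hv⟩ := mem_energies_iff.1 hE
  have h1 := hH.dotProduct_mulVec_nonneg v
  rw [hv, dotProduct_smul, smul_eq_mul] at h1
  exact nonneg_of_mul_star_dotProduct_self hv0 h1

lemma isGroundEnergy_zero {H : ChainOp L} (hH : H.PosSemidef)
    {v : (Fin L → Fin 2) → ℂ} (hv0 : v ≠ 0) (hv : H *ᵥ v = 0) : IsGroundEnergy H 0 :=
  ⟨mem_energies_iff.2 ⟨v, hv0, by simpa using hv⟩, fun _ hE => nonneg_of_mem_energies hH hE⟩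

lemma exists_isLeast_excited {H : ChainOp L} (hH : H.PosSemidef) (h0 : H ≠ 0) :
    ∃ γ, IsLeast {E | E ∈ energies H ∧ 0 < E} γ := by
  obtain ⟨v, t, ht, hv0, hv⟩ := hH.1.exists_eigenvector_of_ne_zero h0
  have hE : t ∈ energies H := mem_energies_iff.2 ⟨v, hv0, by simpa using hv⟩
  have hfin : {E | E ∈ energies H ∧ 0 < E}.Finite := (finite_energies H).subset fun _ h => h.1
  obtain ⟨γ, hγ⟩ := hfin.exists_minimal ⟨t, hE, lt_of_le_of_ne (nonneg_of_mem_energies hH hE) ht.symm⟩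
  exact ⟨γ, hγ.1, fun E hE => (le_total γ E).elim id fun h => hγ.2 hE h⟩

lemma le_of_mem_energies {H : ChainOp L} {c : ℝ} (hc : (H * H - (c : ℂ) • H).PosSemidef) {E : ℝ}
    (hE : E ∈ energies H) (hpos : 0 < E) : c ≤ E := by
  obtain ⟨v, hv0, hv⟩ := mem_energies_iff.1 hE
  have h1 := hc.dotProduct_mulVec_nonneg v
  have h3 : (H * H - (c : ℂ) • H) *ᵥ v = (((E * (E - c) : ℝ)) : ℂ) • v := by
    rw [sub_mulVec, ← mulVec_mulVec, smul_mulVec, hv, mulVec_smul, hv, smul_smul, smul_smul,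
      ← sub_smul]
    push_cast
    ring_nf
  rw [h3, dotProduct_smul, smul_eq_mul] at h1
  have h4 := nonneg_of_mul_star_dotProduct_self hv0 h1
  linarith [nonneg_of_mul_nonneg_right h4 hpos]

/-- In an eigenbasis this is `λ (λ - ε) ≥ 0`, true because each eigenvalue is zero or at least `ε`.
-/
lemma posSemidef_sq_sub_smul {H : ChainOp L} (hH : H.PosSemidef) {ε : ℝ}
    (hε : ∀ E ∈ energies H, 0 < E → ε ≤ E) : (H * H - (ε : ℂ) • H).PosSemidef := by
  have hs := hH.1.spectral_theorem
  rw [Unitary.conjStarAlgAut_apply] at hs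
  set U : ChainOp L := (hH.1.eigenvectorUnitary : ChainOp L) with hU
  set D : ChainOp L := diagonal (RCLike.ofReal ∘ hH.1.eigenvalues) with hD
  have hUU : star U * U = 1 := by simp [hU]
  have h1 : H * H - (ε : ℂ) • H = U * (D * D - (ε : ℂ) • D) * Uᴴ := by
    rw [hs]
    change U * D * star U * (U * D * star U) - _ = U * (D * D - (ε : ℂ) • D) * star U
    rw [show U * D * star U * (U * D * star U) = U * D * (star U * U) * D * star U by
      simp only [mul_assoc], hUU]
    simp only [mul_sub, sub_mul, mul_one, mul_smul_comm, smul_mul_assoc, mul_assoc]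
  rw [h1]
  refine PosSemidef.mul_mul_conjTranspose_same ?_ U
  rw [hD, diagonal_mul_diagonal, ← diagonal_smul, diagonal_sub, posSemidef_diagonal_iff]
  intro i
  have hi : hH.1.eigenvalues i ∈ energies H := mem_energies_iff.2
    ⟨hH.1.eigenvectorBasis i, by
      have := hH.1.eigenvectorBasis.orthonormal.ne_zero i
      intro h
      exact this (by ext j; exact congrFun h j), by simpa using hH.1.mulVec_eigenvectorBasis i⟩
  have h2 : 0 ≤ hH.1.eigenvalues i * hH.1.eigenvalues i - ε * hH.1.eigenvalues i := by
    rcases (hH.eigenvalues_nonneg i).eq_or_lt with h0 | h0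
    · simp [← h0]
    · nlinarith [hε _ hi h0]
  simpa using (by exact_mod_cast h2 : (0 : ℂ) ≤ (hH.1.eigenvalues i : ℂ) * hH.1.eigenvalues i -
    ε * hH.1.eigenvalues i)

/-- A vector whose variance is small compared to its energy forces a small excited energy. -/
lemma exists_gap_lt {H : ChainOp L} (hH : H.PosSemidef) (hg : IsGroundEnergy H 0) (h0 : H ≠ 0)
    {ε : ℝ} {v : (Fin L → Fin 2) → ℂ}
    (hv : (star (H *ᵥ v) ⬝ᵥ (H *ᵥ v)).re < ε * (star v ⬝ᵥ (H *ᵥ v)).re) :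
    ∃ γ, IsSpectralGap H γ ∧ γ < ε := by
  obtain ⟨γ, hγ⟩ := exists_isLeast_excited hH h0
  refine ⟨γ, ⟨0, γ, hg, hγ, (sub_zero γ).symm⟩, ?_⟩
  -- If `ε ≤ γ`, then `H² ≥ ε H`, which evaluated on `v` contradicts `hv`. The vector need not be
  -- orthogonal to the ground space, whose component drops out of both sides.
  by_contra! hle
  have hp := (posSemidef_sq_sub_smul hH (ε := ε) fun E hE hpos => hle.trans (hγ.2 ⟨hE, hpos⟩))
  have h1 := (Complex.le_def.1 (hp.dotProduct_mulVec_nonneg v)).1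
  have h2 : star v ⬝ᵥ (H * H) *ᵥ v = star (H *ᵥ v) ⬝ᵥ (H *ᵥ v) := by
    rw [star_mulVec, hH.1.eq, ← dotProduct_mulVec, mulVec_mulVec]
  rw [sub_mulVec, smul_mulVec, dotProduct_sub, dotProduct_smul, h2, Complex.sub_re, smul_eq_mul,
    Complex.re_ofReal_mul, Complex.zero_re] at h1
  linarith

lemma exists_gap_ge {H : ChainOp L} (hH : H.PosSemidef) (hg : IsGroundEnergy H 0) (h0 : H ≠ 0)
    {c : ℝ} (hc : (H * H - (c : ℂ) • H).PosSemidef) : ∃ γ, IsSpectralGap H γ ∧ c ≤ γ := by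
  obtain ⟨γ, hγ⟩ := exists_isLeast_excited hH h0
  exact ⟨γ, ⟨0, γ, hg, hγ, (sub_zero γ).symm⟩, le_of_mem_energies hc hγ.1.1 hγ.1.2⟩

/-! ### Affine changes of the Hamiltonian -/

lemma affine_mulVec_eq_iff {H K : ChainOp L} {a b : ℝ} (ha : a ≠ 0)
    (hK : K = (a : ℂ) • H + (b : ℂ) • 1) {E : ℝ} {v : (Fin L → Fin 2) → ℂ} :
    K *ᵥ v = ((a * E + b : ℝ) : ℂ) • v ↔ H *ᵥ v = (E : ℂ) • v := by
  have ha' : (a : ℂ) ≠ 0 := by exact_mod_cast ha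
  rw [hK, add_mulVec, smul_mulVec, smul_mulVec, one_mulVec]
  push_cast
  rw [add_smul, add_left_inj, mul_smul, smul_right_inj ha']

lemma affine_mem_energies_iff {H K : ChainOp L} {a b : ℝ} (ha : a ≠ 0)
    (hK : K = (a : ℂ) • H + (b : ℂ) • 1) {E : ℝ} : a * E + b ∈ energies K ↔ E ∈ energies H := by
  simp only [mem_energies_iff, affine_mulVec_eq_iff ha hK]

lemma energySpace_affine {H K : ChainOp L} {a b : ℝ} (ha : a ≠ 0)
    (hK : K = (a : ℂ) • H + (b : ℂ) • 1) (E : ℝ) :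
    energySpace K (a * E + b) = energySpace H E := by
  ext v; rw [mem_energySpace, mem_energySpace, affine_mulVec_eq_iff ha hK]

lemma isLeast_affine {S T : Set ℝ} {a b : ℝ} (ha : 0 < a) (h : ∀ E, a * E + b ∈ T ↔ E ∈ S) {E : ℝ}
    (hE : IsLeast S E) : IsLeast T (a * E + b) := by
  refine ⟨(h E).2 hE.1, fun F hF => ?_⟩
  have hF' : F = a * ((F - b) / a) + b := by field_simp; ring
  rw [hF', h] at hF
  have := hE.2 hF
  rw [le_div_iff₀ ha] at this
  linarith

lemma IsGroundEnergy.affine {H K : ChainOp L} {a b : ℝ} (ha : 0 < a)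
    (hK : K = (a : ℂ) • H + (b : ℂ) • 1) {E : ℝ} (hE : IsGroundEnergy H E) :
    IsGroundEnergy K (a * E + b) :=
  isLeast_affine ha (fun _ => affine_mem_energies_iff ha.ne' hK) hE

lemma IsSpectralGap.affine {H K : ChainOp L} {a b : ℝ} (ha : 0 < a)
    (hK : K = (a : ℂ) • H + (b : ℂ) • 1) {γ : ℝ} (hγ : IsSpectralGap H γ) :
    IsSpectralGap K (a * γ) := by
  obtain ⟨E₀, E₁, h0, h1, rfl⟩ := hγ
  refine ⟨a * E₀ + b, a * E₁ + b, h0.affine ha hK, isLeast_affine ha (fun E => ?_) h1, by ring⟩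
  simp [affine_mem_energies_iff ha.ne' hK, ha]

/-! ### Sums of projections -/

lemma posSemidef_mul_of_commute {n : Type*} [Fintype n] {p q : Matrix n n ℂ} (hp : pᴴ = p)
    (hp2 : p * p = p) (hq : qᴴ = q) (hq2 : q * q = q) (h : Commute p q) : (p * q).PosSemidef := by
  have : p * q = (p * q)ᴴ * (p * q) := by
    rw [conjTranspose_mul, hp, hq, h.eq.symm, mul_assoc, ← mul_assoc q, ← h.eq, mul_assoc p q q,
      hq2, ← mul_assoc, hp2]
  rw [this]
  exact posSemidef_conjTranspose_mul_self _

/-- Complete the square: `(qp + tq)ᴴ (qp + tq)` is `t` times the matrix in question, since `pqp = t²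
p` supplies the missing term. -/
lemma posSemidef_anticommutator {n : Type*} [Fintype n] {p q : Matrix n n ℂ} {t : ℝ} (ht : 0 < t)
    (hp : pᴴ = p) (hq : qᴴ = q) (hq2 : q * q = q)
    (hpqp : p * q * p = ((t : ℂ) ^ 2) • p) :
    (p * q + q * p + (t : ℂ) • (p + q)).PosSemidef := by
  have ht' : (t : ℂ) ≠ 0 := by exact_mod_cast ht.ne'
  have h1 : ((t⁻¹ : ℝ) : ℂ) • ((q * p + (t : ℂ) • q)ᴴ * (q * p + (t : ℂ) • q)) =
      p * q + q * p + (t : ℂ) • (p + q) := by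
    have : (q * p + (t : ℂ) • q)ᴴ * (q * p + (t : ℂ) • q) =
        (t : ℂ) • (p * q + q * p + (t : ℂ) • (p + q)) := by
      rw [conjTranspose_add, conjTranspose_mul, conjTranspose_smul, hp, hq]
      simp only [mul_add, add_mul, smul_mul_assoc, mul_smul_comm, ← mul_assoc, hq2]
      rw [mul_assoc p q q, hq2, hpqp]
      simp only [RCLike.star_def, Complex.conj_ofReal, smul_add, smul_smul, pow_two]
      abel
    rw [this, smul_smul]
    push_cast
    rw [inv_mul_cancel₀ ht', one_smul]
  rw [← h1]
  refine (posSemidef_conjTranspose_mul_self _).smul ?_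
  exact_mod_cast (inv_pos.2 ht).le

/-- For projections obeying the Temperley–Lieb relations, the sum `S` satisfies
`S ^ 2 ≥ (1 - 2 t) S`. -/
lemma posSemidef_sq_sum_projections {n : Type*} [Fintype n] {h : ℕ → Matrix n n ℂ} {N : ℕ} {t : ℝ}
    (ht : 0 < t) (hh : ∀ i, (h i)ᴴ = h i) (hp : ∀ i, h i * h i = h i)
    (hc : ∀ i j, i + 2 ≤ j → Commute (h i) (h j))
    (htl : ∀ i, i + 1 < N → h i * h (i + 1) * h i = ((t : ℂ) ^ 2) • h i) (m : ℕ) (hm : m < N) :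
    ((∑ i ∈ Finset.range (m + 1), h i) * (∑ i ∈ Finset.range (m + 1), h i) -
      ((1 - 2 * t : ℝ) : ℂ) • (∑ i ∈ Finset.range (m + 1), h i) - (t : ℂ) • h m).PosSemidef := by
  have hpsd (i : ℕ) : (h i).PosSemidef := by
    rw [← hp i]; nth_rewrite 1 [← hh i]; exact posSemidef_conjTranspose_mul_self _
  have ht0 : (0 : ℂ) ≤ (t : ℂ) := by exact_mod_cast ht.le
  -- The term `t • h m` is slack. Each neighbouring pair costs `t` of both its projections, and the
  -- last projection has met only one neighbour so far; the slack pays for the next one.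
  induction m with
  | zero =>
    have : h 0 * h 0 - ((1 - 2 * t : ℝ) : ℂ) • h 0 - (t : ℂ) • h 0 = (t : ℂ) • h 0 := by
      rw [hp]; push_cast; module
    simp only [zero_add, Finset.sum_range_one, this]
    exact (hpsd 0).smul ht0
  | succ m ih =>
    have ih := ih (by omega)
    set S := ∑ i ∈ Finset.range m, h i with hS
    -- Distant projections commute, so their products are again projections and only help.
    have h1 : (S * h (m + 1) + h (m + 1) * S).PosSemidef := by
      rw [hS, Finset.sum_mul, Finset.mul_sum]
      refine .add (posSemidef_sum _ fun i hi => ?_) (posSemidef_sum _ fun i hi => ?_)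
      · have := hc i (m + 1) (by have := Finset.mem_range.1 hi; omega)
        exact posSemidef_mul_of_commute (hh _) (hp _) (hh _) (hp _) this
      · have := hc i (m + 1) (by have := Finset.mem_range.1 hi; omega)
        exact posSemidef_mul_of_commute (hh _) (hp _) (hh _) (hp _) this.symm
    have h2 := posSemidef_anticommutator ht (hh m) (hh (m + 1)) (hp (m + 1)) (htl m hm)
    convert (ih.add h1).add h2 using 1
    rw [Finset.sum_range_succ _ (m + 1), Finset.sum_range_succ, ← hS]
    simp only [add_mul, mul_add, hp]
    push_cast
    module

/-! ### Rank-one dimer terms -/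

lemma proj_conjTranspose (ψ : Fin 2 × Fin 2 → ℂ) : (proj ψ)ᴴ = proj ψ := by
  simp [proj, conjTranspose_vecMulVec]

lemma IsUnitState.star_dotProduct_self {ψ : Fin 2 × Fin 2 → ℂ} (h : IsUnitState ψ) :
    star ψ ⬝ᵥ ψ = 1 := by
  simp only [dotProduct, Pi.star_apply, RCLike.star_def, Complex.conj_mul']
  exact_mod_cast h

lemma IsUnitState.proj_mul_self {ψ : Fin 2 × Fin 2 → ℂ} (h : IsUnitState ψ) :
    proj ψ * proj ψ = proj ψ := by
  rw [proj, vecMulVec_mul_vecMulVec, h.star_dotProduct_self, one_smul]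

lemma IsUnitState.ne_zero {ψ : Fin 2 × Fin 2 → ℂ} (h : IsUnitState ψ) : ψ ≠ 0 := by
  rintro rfl
  simp [IsUnitState] at h

lemma bond_sites_ne (i : Fin (L - 1)) :
    (⟨i.val, by omega⟩ : Fin L) ≠ ⟨i.val + 1, by omega⟩ := by
  simp

lemma bond_conjTranspose (h : DimerOp) (i : Fin (L - 1)) :
    (bond h i : ChainOp L)ᴴ = bond hᴴ i := dimerAt_conjTranspose _ _ _

lemma bond_mul (g h : DimerOp) (i : Fin (L - 1)) :
    (bond g i * bond h i : ChainOp L) = bond (g * h) i := dimerAt_mul _ _ (bond_sites_ne i)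

lemma bond_posSemidef {ψ : Fin 2 × Fin 2 → ℂ} (h : IsUnitState ψ) (i : Fin (L - 1)) :
    (bond (proj ψ) i : ChainOp L).PosSemidef := by
  rw [← h.proj_mul_self, ← bond_mul]
  nth_rewrite 1 [← proj_conjTranspose, ← bond_conjTranspose]
  exact posSemidef_conjTranspose_mul_self _

lemma chain_posSemidef {ψ : Fin 2 × Fin 2 → ℂ} (h : IsUnitState ψ) (L : ℕ) :
    (chain (proj ψ) L).PosSemidef := posSemidef_sum _ fun i _ => bond_posSemidef h i

/-- The expectation values of the bonds are nonnegative, so a vanishing sum forces each to vanish.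
Frustration-freeness follows once a zero-energy vector exists. -/
lemma chain_mulVec_eq_zero_iff {ψ : Fin 2 × Fin 2 → ℂ} (h : IsUnitState ψ)
    (v : (Fin L → Fin 2) → ℂ) :
    chain (proj ψ) L *ᵥ v = 0 ↔ ∀ i : Fin (L - 1), bond (proj ψ) i *ᵥ v = 0 := by
  constructor
  · intro hv i
    rw [← (bond_posSemidef h i).dotProduct_mulVec_zero_iff]
    have h1 : ∑ i : Fin (L - 1), star v ⬝ᵥ (bond (proj ψ) i *ᵥ v) = 0 := by
      rw [← dotProduct_sum, ← sum_mulVec, ← chain, hv, dotProduct_zero]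
    exact (Finset.sum_eq_zero_iff_of_nonneg
      fun i _ => (bond_posSemidef h i).dotProduct_mulVec_nonneg v).1 h1 i (Finset.mem_univ _)
  · intro hv
    rw [chain, sum_mulVec]
    exact Finset.sum_eq_zero fun i _ => hv i

lemma dimerAt_vecMulVec_mulVec (φ η : Fin 2 × Fin 2 → ℂ) {j k : Fin L} (hjk : j ≠ k)
    (v : (Fin L → Fin 2) → ℂ) (s : Fin L → Fin 2) :
    (dimerAt (vecMulVec φ η) j k *ᵥ v) s =
      φ (s j, s k) * ∑ p : Fin 2 × Fin 2, η p * v (update (update s j p.1) k p.2) := by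
  rw [dimerAt_mulVec _ hjk, Finset.mul_sum]
  exact Finset.sum_congr rfl fun p _ => by rw [vecMulVec_apply, mul_assoc]

lemma update_update_update_update {α : Type*} {j k : Fin L} (hjk : j ≠ k)
    (s : Fin L → α) (x y z w : α) :
    update (update (update (update s j x) k y) j z) k w = update (update s j z) k w := by
  funext m
  by_cases hk : m = k
  · subst hk; simp
  by_cases hj : m = j
  · subst hj; simp [hjk]
  simp [hk, hj]

lemma dimerAt_vecMulVec_mulVec_eq_zero_iff {φ : Fin 2 × Fin 2 → ℂ} (hφ : φ ≠ 0)
    (η : Fin 2 × Fin 2 → ℂ) {j k : Fin L} (hjk : j ≠ k) (v : (Fin L → Fin 2) → ℂ) :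
    dimerAt (vecMulVec φ η) j k *ᵥ v = 0 ↔
      ∀ s, ∑ p : Fin 2 × Fin 2, η p * v (update (update s j p.1) k p.2) = 0 := by
  constructor
  · intro h s
    obtain ⟨q, hq⟩ := Function.ne_iff.1 hφ
    -- The contraction with `η` ignores the values of `s` at `j` and `k`, so these may be reset to
    -- make the prefactor `φ q` nonzero.
    have h1 := congrFun h (update (update s j q.1) k q.2)
    rw [dimerAt_vecMulVec_mulVec _ _ hjk] at h1
    simp only [update_update_update_update hjk] at h1
    rw [update_of_ne hjk, update_self, update_self] at h1
    exact (mul_eq_zero.1 h1).resolve_left hq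
  · intro h
    funext s
    rw [dimerAt_vecMulVec_mulVec _ _ hjk, h, mul_zero, Pi.zero_apply]

/-! ### Permutation-invariant functions -/

/-- The multiset of the values of `s`. -/
def content (s : Fin L → Fin 2) : Sym (Fin 2) L := ⟨Finset.univ.val.map s, by simp⟩

lemma content_surjective : Surjective (content : (Fin L → Fin 2) → Sym (Fin 2) L) := by
  rintro ⟨m, hm⟩
  induction m using Quotient.inductionOn with
  | h l =>
    subst hm
    refine ⟨l.get, Subtype.ext ?_⟩
    change Multiset.map l.get (Finset.univ : Finset (Fin l.length)).val = (l : Multiset (Fin 2))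
    rw [Fin.univ_val_map, List.ofFn_get]

lemma content_comp_perm (s : Fin L → Fin 2) (σ : Equiv.Perm (Fin L)) :
    content (s ∘ σ) = content s := by
  refine Subtype.ext ?_
  change Multiset.map (s ∘ σ) Finset.univ.val = Multiset.map s Finset.univ.val
  rw [← Multiset.map_map, Multiset.map_univ_val_equiv]

lemma exists_perm_of_content_eq {s t : Fin L → Fin 2} (h : content s = content t) :
    ∃ σ : Equiv.Perm (Fin L), t ∘ σ = s := by
  have hc (x : Fin 2) : Nonempty ({k // s k = x} ≃ {k // t k = x}) := by
    rw [← Fintype.card_eq, Fintype.card_subtype, Fintype.card_subtype]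
    have h1 := congrArg (fun m : Sym (Fin 2) L => Multiset.count x m.val) h
    simp only [content, Multiset.count_map] at h1
    simpa [Finset.card_def, eq_comm] using h1
  exact ⟨Equiv.ofFiberEquiv fun x => (hc x).some, funext fun k => Equiv.ofFiberEquiv_map _ k⟩

lemma update_update_comp_swap {j k : Fin L} (hjk : j ≠ k) (s : Fin L → Fin 2) (x y : Fin 2) :
    update (update s j x) k y ∘ Equiv.swap j k = update (update s j y) k x := by
  funext m
  by_cases hk : m = k
  · subst hk; simp [hjk]
  by_cases hj : m = j
  · subst hj; simp [hk]
  simp [hk, hj, Equiv.swap_apply_of_ne_of_ne hj hk]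

/-- Adjacent transpositions generate the symmetric group, and `content` separates exactly the orbits
of configurations. -/
lemma swap_invariant_iff {n : ℕ} (w : (Fin (n + 1) → Fin 2) → ℂ) :
    (∀ (i : Fin n) (s : Fin (n + 1) → Fin 2), w (update (update s i.castSucc 0) i.succ 1) =
      w (update (update s i.castSucc 1) i.succ 0)) ↔ ∃ g, g ∘ content = w := by
  have hne (i : Fin n) : i.castSucc ≠ i.succ := by simp [Fin.ext_iff]
  constructor
  · intro h
    have h1 (i : Fin n) (s : Fin (n + 1) → Fin 2) : w (s ∘ Equiv.swap i.castSucc i.succ) = w s := by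
      obtain ⟨x, hx⟩ : ∃ x, x = s i.castSucc := ⟨_, rfl⟩
      obtain ⟨y, hy⟩ : ∃ y, y = s i.succ := ⟨_, rfl⟩
      have hs : s = update (update s i.castSucc x) i.succ y := by
        rw [hx, update_eq_self, hy, update_eq_self]
      rw [hs, update_update_comp_swap (hne i)]
      have := h i s
      clear hx hy hs
      fin_cases x <;> fin_cases y <;> simp_all
    have h2 (σ : Equiv.Perm (Fin (n + 1))) : ∀ s, w (s ∘ σ) = w s := by
      have hσ : σ ∈ Submonoid.closure
          (Set.range fun i : Fin n ↦ Equiv.swap i.castSucc i.succ) := by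
        rw [Equiv.Perm.mclosure_swap_castSucc_succ]; trivial
      induction hσ using Submonoid.closure_induction with
      | mem σ hσ => obtain ⟨i, rfl⟩ := hσ; exact h1 i
      | one => intro s; rfl
      | mul σ τ _ _ h1 h2 =>
        intro s
        rw [Equiv.Perm.coe_mul, ← comp_assoc, h2, h1]
    refine ⟨fun c => w (surjInv content_surjective c), funext fun s => ?_⟩
    obtain ⟨σ, hσ⟩ := exists_perm_of_content_eq (surjInv_eq content_surjective (content s))
    rw [Function.comp_apply, ← hσ, h2]
  · rintro ⟨g, rfl⟩ i s
    simp only [Function.comp_apply]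
    rw [← update_update_comp_swap (hne i), content_comp_perm]

/-! ### The ground space -/

/-- A 2 × 2 coefficient matrix with zero determinant has rank at most one and factors as a product
vector. -/
lemma IsEntangled.det_ne_zero {ψ : Fin 2 × Fin 2 → ℂ} (h : IsEntangled ψ) :
    ψ (0, 0) * ψ (1, 1) - ψ (0, 1) * ψ (1, 0) ≠ 0 := by
  intro h0
  apply h
  by_cases ha : ψ (0, 0) = 0
  · by_cases hb : ψ (0, 1) = 0
    · refine ⟨![0, 1], fun y => ψ (1, y), fun x y => ?_⟩
      fin_cases x <;> fin_cases y <;> simp [ha, hb]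
    · have hc : ψ (1, 0) = 0 := by simpa [ha, hb] using h0
      refine ⟨![1, ψ (1, 1) / ψ (0, 1)], fun y => ψ (0, y), fun x y => ?_⟩
      fin_cases x <;> fin_cases y <;> simp [ha, hb, hc]
  · refine ⟨![1, ψ (1, 0) / ψ (0, 0)], fun y => ψ (0, y), fun x y => ?_⟩
    fin_cases x <;> fin_cases y <;> simp [ha]
    field_simp
    linear_combination h0

/-- The single-qubit operator `G` for which `⟨ψ|` is the singlet functional composed with
`1 ⊗ G`. -/
def singletTwist (ψ : Fin 2 × Fin 2 → ℂ) : QubitOp :=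
  !![-star (ψ (1, 0)), -star (ψ (1, 1)); star (ψ (0, 0)), star (ψ (0, 1))]

/-- The coefficients of the singlet functional. -/
def singlet : Fin 2 × Fin 2 → ℂ := ket 0 1 - ket 1 0

lemma det_singletTwist_ne_zero {ψ : Fin 2 × Fin 2 → ℂ} (h : IsEntangled ψ) :
    (singletTwist ψ).det ≠ 0 := by
  have h1 := star_ne_zero.2 h.det_ne_zero
  rw [singletTwist, det_fin_two_of]
  convert h1 using 1
  simp
  ring

/-- The singlet is alternating, so `P ⊗ P` multiplies it by `det P`; the remaining factor `1 ⊗ G`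
converts it to `⟨ψ|`. -/
lemma singlet_vecMul_kronecker (ψ : Fin 2 × Fin 2 → ℂ) (P : QubitOp) :
    singlet ᵥ* (P ⊗ₖ (P * singletTwist ψ)) = P.det • star ψ := by
  funext ⟨x, y⟩
  simp only [vecMul, dotProduct, Fintype.sum_prod_type, Fin.sum_univ_two, kronecker_apply,
    Matrix.mul_apply, det_fin_two, Pi.smul_apply, Pi.star_apply, smul_eq_mul]
  fin_cases x <;> fin_cases y <;> simp [singlet, ket, singletTwist] <;> ring

/-- With `G ^ k` on site `k`, neighbouring sites differ by exactly one factor `G`. The same operator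
`T` therefore turns all bonds into singlet constraints simultaneously, up to nonzero determinants.
-/
lemma bond_mulVec_eq_zero_iff {ψ : Fin 2 × Fin 2 → ℂ} (hψ : IsEntangled ψ) (h : IsUnitState ψ)
    (i : Fin (L - 1)) (v : (Fin L → Fin 2) → ℂ) {T : ChainOp L}
    (hT : T = tensorOp fun k => singletTwist ψ ^ k.val) (hu : IsUnit T) :
    bond (proj ψ) i *ᵥ v = 0 ↔ ∀ s,
      (T *ᵥ v) (update (update s ⟨i.val, by omega⟩ 0) ⟨i.val + 1, by omega⟩ 1) =
      (T *ᵥ v) (update (update s ⟨i.val, by omega⟩ 1) ⟨i.val + 1, by omega⟩ 0) := by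
  set G := singletTwist ψ with hG
  have hdet : G.det ≠ 0 := det_singletTwist_ne_zero hψ
  set K := (G ^ i.val) ⊗ₖ (G ^ (i.val + 1)) with hK
  have hKdet : K.det ≠ 0 := by
    rw [hK, det_kronecker, det_pow, det_pow]
    positivity
  have hKψ : K *ᵥ ψ ≠ 0 := fun h0 => h.ne_zero (eq_zero_of_mulVec_eq_zero hKdet h0)
  have h1 : K * proj ψ = vecMulVec (K *ᵥ ψ) (((G ^ i.val).det)⁻¹ • singlet) * K := by
    rw [proj, mul_vecMulVec, vecMulVec_mul, smul_vecMul, hK, pow_succ, singlet_vecMul_kronecker,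
      smul_smul, inv_mul_cancel₀ (by rw [det_pow]; positivity), one_smul]
  have h2 : T * bond (proj ψ) i = dimerAt _ _ _ * T :=
    hT ▸ tensorOp_mul_dimerAt (fun k : Fin L => G ^ k.val) (bond_sites_ne i) h1
  have h3 : bond (proj ψ) i *ᵥ v = 0 ↔ T *ᵥ (bond (proj ψ) i *ᵥ v) = 0 :=
    ⟨fun h0 => by rw [h0, mulVec_zero],
      fun h0 => mulVec_injective_of_isUnit hu (by rw [h0, mulVec_zero])⟩
  rw [h3, mulVec_mulVec, h2, ← mulVec_mulVec,
    dimerAt_vecMulVec_mulVec_eq_zero_iff hKψ _ (bond_sites_ne i)]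
  refine forall_congr' fun s => ?_
  have hd : (G ^ i.val).det ≠ 0 := by rw [det_pow]; positivity
  simp [Fintype.sum_prod_type, singlet, ket]
  rw [← sub_eq_add_neg, sub_eq_zero]
  simp [hdet]

lemma finrank_energySpace_chain {ψ : Fin 2 × Fin 2 → ℂ} (h : IsUnitState ψ) (hψ : IsEntangled ψ)
    (hL : 1 ≤ L) : Module.finrank ℂ (energySpace (chain (proj ψ) L) 0) = L + 1 := by
  obtain ⟨n, rfl⟩ : ∃ n, L = n + 1 := ⟨L - 1, by omega⟩
  set G := singletTwist ψ with hG
  have hdet : IsUnit G.det := (det_singletTwist_ne_zero hψ).isUnit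
  set T : ChainOp (n + 1) := tensorOp fun k => G ^ k.val with hT
  set T' : ChainOp (n + 1) := tensorOp fun k => (G ^ k.val)⁻¹ with hT'
  have hdk (k : ℕ) : IsUnit (G ^ k).det := by rw [det_pow]; exact hdet.pow k
  have h1 : T * T' = 1 := by
    rw [hT, hT', tensorOp_mul, ← tensorOp_one]
    congr 1; funext k; exact mul_nonsing_inv _ (hdk _)
  have h2 : T' * T = 1 := mul_eq_one_comm.1 h1
  have hu : IsUnit T := ⟨⟨T, T', h1, h2⟩, rfl⟩
  have hmem (v) : v ∈ energySpace (chain (proj ψ) (n + 1)) 0 ↔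
      T *ᵥ v ∈ LinearMap.range (LinearMap.funLeft ℂ ℂ (content (L := n + 1))) := by
    rw [mem_energySpace, Complex.ofReal_zero, zero_smul, chain_mulVec_eq_zero_iff h]
    rw [LinearMap.mem_range]
    refine Iff.trans (forall_congr' fun i => bond_mulVec_eq_zero_iff hψ h i v hT hu) ?_
    exact swap_invariant_iff (T *ᵥ v)
  have he : energySpace (chain (proj ψ) (n + 1)) 0 =
      (LinearMap.range (LinearMap.funLeft ℂ ℂ (content (L := n + 1)))).comap
        (Matrix.toLin'OfInv h2 h1).toLinearMap := by
    ext v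
    rw [hmem, Submodule.mem_comap]
    rfl
  rw [he, Submodule.comap_equiv_eq_map_symm,
    LinearEquiv.finrank_map_eq,
    LinearMap.finrank_range_of_inj (LinearMap.funLeft_injective_of_surjective ℂ ℂ _
      content_surjective), Module.finrank_fintype_fun_eq_card, Sym.card_sym_eq_multichoose,
    Fintype.card_fin, Nat.multichoose_two]

/-- A zero chain would have a kernel of dimension `2 ^ L`, more than `L + 1`. This guarantees that
an excited energy exists. -/
lemma chain_ne_zero {ψ : Fin 2 × Fin 2 → ℂ} (h : IsUnitState ψ) (hψ : IsEntangled ψ)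
    (hL : 2 ≤ L) : chain (proj ψ) L ≠ 0 := by
  intro h0
  have h1 := finrank_energySpace_chain h hψ (L := L) (by omega)
  have h2 : energySpace (chain (proj ψ) L) 0 = ⊤ := by
    ext v; simp [mem_energySpace, h0]
  rw [h2, finrank_top, Module.finrank_fintype_fun_eq_card, Fintype.card_fun, Fintype.card_fin,
    Fintype.card_fin] at h1
  have h3 : ∀ n, n + 2 + 1 < 2 ^ (n + 2) := by
    intro n
    induction n with
    | zero => norm_num
    | succ n ih => rw [show n + 1 + 2 = (n + 2) + 1 from rfl, pow_succ]; omega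
  have := h3 (L - 2)
  rw [show L - 2 + 2 = L by omega] at this
  omega

lemma exists_ground_state {ψ : Fin 2 × Fin 2 → ℂ} (h : IsUnitState ψ) (hψ : IsEntangled ψ)
    (hL : 1 ≤ L) : ∃ v, v ≠ 0 ∧ chain (proj ψ) L *ᵥ v = 0 := by
  have h1 := finrank_energySpace_chain h hψ hL
  have h2 : energySpace (chain (proj ψ) L) 0 ≠ ⊥ := by
    intro h0
    rw [h0, finrank_bot] at h1
    omega
  obtain ⟨v, hv, hv0⟩ := (Submodule.ne_bot_iff _).1 h2
  exact ⟨v, hv0, by simpa [mem_energySpace] using hv⟩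

lemma isGroundEnergy_chain {ψ : Fin 2 × Fin 2 → ℂ} (h : IsUnitState ψ) (hψ : IsEntangled ψ)
    (hL : 1 ≤ L) : IsGroundEnergy (chain (proj ψ) L) 0 := by
  obtain ⟨v, hv0, hv⟩ := exists_ground_state h hψ hL
  exact isGroundEnergy_zero (chain_posSemidef h L) hv0 hv

lemma isGroundEnergy_bond {ψ : Fin 2 × Fin 2 → ℂ} (h : IsUnitState ψ) (hψ : IsEntangled ψ)
    (i : Fin (L - 1)) : IsGroundEnergy (bond (proj ψ) i : ChainOp L) 0 := by
  obtain ⟨v, hv0, hv⟩ := exists_ground_state h hψ (L := L) (by have := i.isLt; omega)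
  exact isGroundEnergy_zero (bond_posSemidef h i) hv0 ((chain_mulVec_eq_zero_iff h v).1 hv i)

lemma energySpace_chain_le {ψ : Fin 2 × Fin 2 → ℂ} (h : IsUnitState ψ) (i : Fin (L - 1)) :
    energySpace (chain (proj ψ) L) 0 ≤ energySpace (bond (proj ψ) i) 0 := by
  intro v hv
  rw [mem_energySpace, Complex.ofReal_zero, zero_smul] at hv ⊢
  exact (chain_mulVec_eq_zero_iff h v).1 hv i

lemma isFrustrationFree {ψ : Fin 2 × Fin 2 → ℂ} (h : IsUnitState ψ) (hψ : IsEntangled ψ)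
    (hL : 1 ≤ L) : IsFrustrationFree (proj ψ) L := by
  intro E hE i
  obtain rfl := hE.unique (isGroundEnergy_chain h hψ hL)
  exact ⟨0, isGroundEnergy_bond h hψ i, energySpace_chain_le h i⟩

/-! ### Unequal odd amplitudes: the gap -/

/-- The Temperley–Lieb relation for neighbouring dimer projections. -/
lemma dimerAt_proj_mul_mul {ψ : Fin 2 × Fin 2 → ℂ} (h0 : ψ (0, 0) = 0) (h1 : ψ (1, 1) = 0)
    {i j k : Fin L} (hij : i ≠ j) (hik : i ≠ k) (hjk : j ≠ k) :
    dimerAt (proj ψ) i j * dimerAt (proj ψ) j k * dimerAt (proj ψ) i j =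
      (((‖ψ (0, 1)‖ * ‖ψ (1, 0)‖ : ℝ) : ℂ) ^ 2) • dimerAt (proj ψ) i j := by
  refine ext_mulVec fun v => ?_
  -- `C` is `v` contracted with `⟨ψ|` on sites `i, j`; it no longer depends on those sites.
  set C : (Fin L → Fin 2) → ℂ := fun s =>
    ∑ p : Fin 2 × Fin 2, star ψ p * v (update (update s i p.1) j p.2) with hC
  have hCi (s : Fin L → Fin 2) (x : Fin 2) : C (update s i x) = C s := by
    simp only [hC, update_idem]
  have hCj (s : Fin L → Fin 2) (x : Fin 2) : C (update s j x) = C s := by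
    simp only [hC]
    refine Finset.sum_congr rfl fun p _ => ?_
    rw [update_comm hij.symm, update_idem]
  have hu : dimerAt (proj ψ) i j *ᵥ v = fun s => ψ (s i, s j) * C s :=
    funext fun s => dimerAt_vecMulVec_mulVec _ _ hij v s
  have hw : dimerAt (proj ψ) j k *ᵥ (fun s => ψ (s i, s j) * C s) = fun s =>
      ψ (s j, s k) * ∑ q : Fin 2 × Fin 2, star ψ q * (ψ (s i, q.1) * C (update s k q.2)) := by
    funext s
    rw [proj, dimerAt_vecMulVec_mulVec _ _ hjk]
    congr 1
    refine Finset.sum_congr rfl fun q _ => ?_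
    rw [update_comm hjk, hCj]
    simp [hij, hik]
  -- Oddness leaves one surviving term for each `z`, and its weight is `|b|² |c|²`.
  have key (z : Fin 2) (F : Fin 2 → ℂ) :
      ∑ p : Fin 2 × Fin 2, star ψ p * (ψ (p.2, z) *
        ∑ q : Fin 2 × Fin 2, star ψ q * (ψ (p.1, q.1) * F q.2)) =
      (((‖ψ (0, 1)‖ * ‖ψ (1, 0)‖ : ℝ) : ℂ) ^ 2) * F z := by
    have e0 := Complex.mul_conj' (ψ (0, 1))
    have e1 := Complex.mul_conj' (ψ (1, 0))
    push_cast
    rw [mul_pow, ← e0, ← e1]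
    fin_cases z <;>
      simp [Fintype.sum_prod_type, Fin.sum_univ_two, h0, h1] <;> ring
  rw [← mulVec_mulVec, ← mulVec_mulVec, smul_mulVec, hu, hw]
  funext s
  rw [proj, dimerAt_vecMulVec_mulVec _ _ hij]
  simp only [update_of_ne hij, update_self, update_of_ne hik.symm, update_of_ne hjk.symm]
  have hCu (p q : Fin 2 × Fin 2) :
      C (update (update (update s i p.1) j p.2) k q.2) = C (update s k q.2) := by
    rw [update_comm hjk, hCj, update_comm hik, hCi]
  simp only [hCu]
  rw [key (s k) fun z => C (update s k z), update_eq_self]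
  simp only [Pi.smul_apply, smul_eq_mul]
  ring

lemma mem_oddSector_iff {ψ : Fin 2 × Fin 2 → ℂ} :
    ψ ∈ oddSector ↔ ψ (0, 0) = 0 ∧ ψ (1, 1) = 0 := by
  rw [oddSector, Submodule.mem_span_pair]
  constructor
  · rintro ⟨a, b, rfl⟩; simp [ket]
  · rintro ⟨h0, h1⟩
    refine ⟨ψ (0, 1), ψ (1, 0), ?_⟩
    ext ⟨x, y⟩
    fin_cases x <;> fin_cases y <;> simp [ket, h0, h1]

lemma mem_evenSector_iff {ψ : Fin 2 × Fin 2 → ℂ} :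
    ψ ∈ evenSector ↔ ψ (0, 1) = 0 ∧ ψ (1, 0) = 0 := by
  rw [evenSector, Submodule.mem_span_pair]
  constructor
  · rintro ⟨a, b, rfl⟩; simp [ket]
  · rintro ⟨h0, h1⟩
    refine ⟨ψ (0, 0), ψ (1, 1), ?_⟩
    ext ⟨x, y⟩
    fin_cases x <;> fin_cases y <;> simp [ket, h0, h1]

lemma IsEntangled.odd_ne_zero {ψ : Fin 2 × Fin 2 → ℂ} (h : IsEntangled ψ) (ho : ψ ∈ oddSector) :
    ψ (0, 1) ≠ 0 ∧ ψ (1, 0) ≠ 0 := by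
  have := h.det_ne_zero
  simpa [(mem_oddSector_iff.1 ho).1] using this

lemma IsEntangled.even_ne_zero {ψ : Fin 2 × Fin 2 → ℂ} (h : IsEntangled ψ) (he : ψ ∈ evenSector) :
    ψ (0, 0) ≠ 0 ∧ ψ (1, 1) ≠ 0 := by
  have := h.det_ne_zero
  simpa [(mem_evenSector_iff.1 he).1] using this

lemma IsUnitState.odd_norm_sq {ψ : Fin 2 × Fin 2 → ℂ} (h : IsUnitState ψ) (ho : ψ ∈ oddSector) :
    ‖ψ (0, 1)‖ ^ 2 + ‖ψ (1, 0)‖ ^ 2 = 1 := by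
  obtain ⟨h0, h1⟩ := mem_oddSector_iff.1 ho
  simpa [IsUnitState, Fintype.sum_prod_type, h0, h1] using h

/-- The dimer term on sites `i, i + 1`, extended by zero beyond the end of the chain. -/
def bondExt (h : DimerOp) (L i : ℕ) : ChainOp L := if hi : i < L - 1 then bond h ⟨i, hi⟩ else 0

lemma chain_eq_sum_range (h : DimerOp) (L : ℕ) :
    chain h L = ∑ i ∈ Finset.range (L - 1), bondExt h L i := by
  rw [chain, Finset.sum_range]
  exact Finset.sum_congr rfl fun i _ => by rw [bondExt, dif_pos i.isLt]

lemma chain_gap_bound {ψ : Fin 2 × Fin 2 → ℂ} (h : IsUnitState ψ) (hψ : IsEntangled ψ)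
    (ho : ψ ∈ oddSector) (hL : 2 ≤ L) :
    (chain (proj ψ) L * chain (proj ψ) L -
      ((1 - 2 * (‖ψ (0, 1)‖ * ‖ψ (1, 0)‖) : ℝ) : ℂ) • chain (proj ψ) L).PosSemidef := by
  set t := ‖ψ (0, 1)‖ * ‖ψ (1, 0)‖ with ht
  obtain ⟨hb, hc⟩ := hψ.odd_ne_zero ho
  obtain ⟨h0, h1⟩ := mem_oddSector_iff.1 ho
  have htpos : 0 < t := mul_pos (norm_pos_iff.2 hb) (norm_pos_iff.2 hc)
  have hh (i : ℕ) : (bondExt (proj ψ) L i)ᴴ = bondExt (proj ψ) L i := by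
    unfold bondExt
    split_ifs
    · rw [bond_conjTranspose, proj_conjTranspose]
    · exact conjTranspose_zero
  have hp (i : ℕ) : bondExt (proj ψ) L i * bondExt (proj ψ) L i = bondExt (proj ψ) L i := by
    unfold bondExt
    split_ifs
    · rw [bond_mul, h.proj_mul_self]
    · exact mul_zero _
  have hcomm (i j : ℕ) (hij : i + 2 ≤ j) :
      Commute (bondExt (proj ψ) L i) (bondExt (proj ψ) L j) := by
    unfold bondExt
    split_ifs
    · apply dimerAt_commute <;> simp [Fin.ext_iff] <;> omega
    · exact Commute.zero_right _
    · exact Commute.zero_left _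
    · exact Commute.zero_left _
  have htl (i : ℕ) (hi : i + 1 < L - 1) : bondExt (proj ψ) L i * bondExt (proj ψ) L (i + 1) *
      bondExt (proj ψ) L i = ((t : ℂ) ^ 2) • bondExt (proj ψ) L i := by
    simp only [bondExt, dif_pos hi, dif_pos (show i < L - 1 by omega)]
    exact dimerAt_proj_mul_mul h0 h1 (by simp) (by simp [Fin.ext_iff, add_assoc]) (by simp)
  have hm := posSemidef_sq_sum_projections htpos hh hp hcomm htl (L - 2) (by omega)
  rw [show L - 2 + 1 = L - 1 by omega, ← chain_eq_sum_range] at hm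
  have hl : ((t : ℂ) • bondExt (proj ψ) L (L - 2)).PosSemidef := by
    rw [← hp]
    nth_rewrite 1 [← hh]
    refine (posSemidef_conjTranspose_mul_self _).smul ?_
    exact_mod_cast htpos.le
  simpa using hm.add hl

lemma gapped_of_odd {ψ : Fin 2 × Fin 2 → ℂ} (h : IsUnitState ψ) (hψ : IsEntangled ψ)
    (ho : ψ ∈ oddSector) (hne : ‖ψ (0, 1)‖ ≠ ‖ψ (1, 0)‖) : Gapped (proj ψ) := by
  refine ⟨1 - 2 * (‖ψ (0, 1)‖ * ‖ψ (1, 0)‖), ?_, fun L hL =>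
    exists_gap_ge (chain_posSemidef h L) (isGroundEnergy_chain h hψ (by omega))
      (chain_ne_zero h hψ hL) (chain_gap_bound h hψ ho hL)⟩
  have h1 := h.odd_norm_sq ho
  -- By normalization this square equals the claimed gap bound `1 - 2|b||c|`.
  have h2 : 0 < (‖ψ (0, 1)‖ - ‖ψ (1, 0)‖) ^ 2 := by
    have := sub_ne_zero.2 hne
    positivity
  nlinarith

/-! ### Single spin flips: the gapless cases -/

/-- The configuration `n` with the spin at site `k` flipped. -/
def flipped (L : ℕ) (n : ℕ → Fin 2) (k : ℕ) : Fin L → Fin 2 :=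
  fun m => if m.val = k then n m + 1 else n m

/-- The basis vector of the configuration `n` with the spin at site `k` flipped. -/
def flipVec (L : ℕ) (n : ℕ → Fin 2) (k : ℕ) : (Fin L → Fin 2) → ℂ := Pi.single (flipped L n k) 1

lemma fin_two_add_one_ne (x : Fin 2) : x + 1 ≠ x := by fin_cases x <;> simp

lemma fin_two_eq_or (x y : Fin 2) : x = y ∨ x = y + 1 := by
  fin_cases x <;> fin_cases y <;> simp

lemma flipped_injOn {n : ℕ → Fin 2} {k l : ℕ} (hk : k < L) (h : flipped L n k = flipped L n l) :
    k = l := by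
  by_contra hkl
  have := congrFun h ⟨k, hk⟩
  simp [flipped, hkl] at this

lemma eq_flipped_left_iff (n : ℕ → Fin 2) (i : Fin (L - 1)) (s : Fin L → Fin 2) :
    s = flipped L n i ↔
      (∀ m : Fin L, m ≠ ⟨i.val, by omega⟩ → m ≠ ⟨i.val + 1, by omega⟩ → s m = n m) ∧
        s ⟨i.val, by omega⟩ = n i + 1 ∧ s ⟨i.val + 1, by omega⟩ = n (i + 1) := by
  constructor
  · rintro rfl
    refine ⟨fun m h1 _ => ?_, by simp [flipped], by simp [flipped]⟩
    simp only [ne_eq, Fin.ext_iff] at h1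
    simp [flipped, h1]
  · rintro ⟨h, h1, h2⟩
    funext m
    by_cases hm : m = ⟨i.val, by omega⟩
    · subst hm; simp [flipped, h1]
    by_cases hm' : m = ⟨i.val + 1, by omega⟩
    · subst hm'; simp [flipped, h2]
    rw [h m hm hm', flipped, if_neg (by simpa [Fin.ext_iff] using hm)]

lemma eq_flipped_right_iff (n : ℕ → Fin 2) (i : Fin (L - 1)) (s : Fin L → Fin 2) :
    s = flipped L n (i + 1) ↔
      (∀ m : Fin L, m ≠ ⟨i.val, by omega⟩ → m ≠ ⟨i.val + 1, by omega⟩ → s m = n m) ∧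
        s ⟨i.val, by omega⟩ = n i ∧ s ⟨i.val + 1, by omega⟩ = n (i + 1) + 1 := by
  constructor
  · rintro rfl
    refine ⟨fun m _ h1 => ?_, by simp [flipped], by simp [flipped]⟩
    simp only [ne_eq, Fin.ext_iff] at h1
    simp [flipped, h1]
  · rintro ⟨h, h1, h2⟩
    funext m
    by_cases hm : m = ⟨i.val, by omega⟩
    · subst hm; simp [flipped, h1]
    by_cases hm' : m = ⟨i.val + 1, by omega⟩
    · subst hm'; simp [flipped, h2]
    rw [h m hm hm', flipped, if_neg (by simpa [Fin.ext_iff] using hm')]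

/-- By `h0` a bond annihilates a state unflipped on its two sites and never produces one; by `h1` it
never flips both. Single flips therefore span an invariant space, on which each bond has rank at
most one. -/
lemma bond_mulVec_flipVec {ψ : Fin 2 × Fin 2 → ℂ} {n : ℕ → Fin 2}
    (h0 : ∀ i, ψ (n i, n (i + 1)) = 0) (h1 : ∀ i, ψ (n i + 1, n (i + 1) + 1) = 0)
    (i : Fin (L - 1)) (k : ℕ) :
    bond (proj ψ) i *ᵥ flipVec L n k =
      (if k = i then star (ψ (n i + 1, n (i + 1))) else
        if k = i + 1 then star (ψ (n i, n (i + 1) + 1)) else 0) •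
      (ψ (n i + 1, n (i + 1)) • flipVec L n i + ψ (n i, n (i + 1) + 1) • flipVec L n (i + 1)) := by
  have hΦ : (ψ (n i + 1, n (i + 1)) • flipVec L n i +
      ψ (n i, n (i + 1) + 1) • flipVec L n (i + 1)) = fun s : Fin L → Fin 2 =>
      if ∀ m : Fin L, m ≠ ⟨i.val, by omega⟩ → m ≠ ⟨i.val + 1, by omega⟩ → s m = n m then
        ψ (s ⟨i.val, by omega⟩, s ⟨i.val + 1, by omega⟩) else 0 := by
    funext s
    simp only [flipVec, Pi.add_apply, Pi.smul_apply, Pi.single_apply, smul_eq_mul, mul_ite, mul_one,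
      mul_zero, eq_flipped_left_iff, eq_flipped_right_iff]
    by_cases hP : ∀ m : Fin L, m ≠ ⟨i.val, by omega⟩ → m ≠ ⟨i.val + 1, by omega⟩ → s m = n m
    · simp only [and_iff_right hP, if_pos hP]
      rcases fin_two_eq_or (s ⟨i.val, by omega⟩) (n i) with e1 | e1 <;>
      rcases fin_two_eq_or (s ⟨i.val + 1, by omega⟩) (n (i + 1)) with e2 | e2 <;>
      simp [e1, e2, h0, h1, -left_eq_add, -add_eq_left, fin_two_add_one_ne,
        (fin_two_add_one_ne _).symm]
    · rw [if_neg fun h => hP h.1, if_neg fun h => hP h.1, if_neg hP, add_zero]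
  rw [hΦ]
  funext s
  rw [flipVec, mulVec_single_one]
  simp only [col_apply, bond, dimerAt, of_apply, proj, vecMulVec_apply, Pi.smul_apply, smul_eq_mul,
    Pi.star_apply]
  by_cases hki : k = i
  · subst hki
    have hs : (∀ m : Fin L, m ≠ ⟨i.val, by omega⟩ → m ≠ ⟨i.val + 1, by omega⟩ →
        s m = flipped L n i m) ↔ ∀ m : Fin L, m ≠ ⟨i.val, by omega⟩ →
          m ≠ ⟨i.val + 1, by omega⟩ → s m = n m :=
      forall_congr' fun m => forall_congr' fun hm => forall_congr' fun hm' => by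
        rw [flipped, if_neg (by simpa [Fin.ext_iff] using hm)]
    simp only [hs]
    simp [flipped, mul_comm]
  by_cases hki' : k = i + 1
  · subst hki'
    have hs : (∀ m : Fin L, m ≠ ⟨i.val, by omega⟩ → m ≠ ⟨i.val + 1, by omega⟩ →
        s m = flipped L n (i + 1) m) ↔ ∀ m : Fin L, m ≠ ⟨i.val, by omega⟩ →
          m ≠ ⟨i.val + 1, by omega⟩ → s m = n m :=
      forall_congr' fun m => forall_congr' fun hm => forall_congr' fun hm' => by
        rw [flipped, if_neg (by simpa [Fin.ext_iff] using hm')]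
    simp only [hs]
    simp [flipped, mul_comm]
  · simp [flipped, hki, hki', Ne.symm hki, Ne.symm hki', h0]

lemma sum_range_telescope {M : Type*} [AddCommGroup M] [Module ℂ M] (e : ℕ → M) (x y : ℕ → ℂ)
    (h : ∀ i, y i + x (i + 1) = 0) (N : ℕ) :
    ∑ i ∈ Finset.range (N + 1), (x i • e i + y i • e (i + 1)) =
      x 0 • e 0 + y N • e (N + 1) := by
  induction N with
  | zero => simp
  | succ N ih =>
    rw [Finset.sum_range_succ, ih, eq_neg_of_add_eq_zero_left (h N)]
    module

lemma IsUnitState.norm_le_one {ψ : Fin 2 × Fin 2 → ℂ} (h : IsUnitState ψ) (x : Fin 2 × Fin 2) :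
    ‖ψ x‖ ^ 2 ≤ 1 := by
  rw [← show ∑ x, ‖ψ x‖ ^ 2 = 1 from h]
  exact Finset.single_le_sum (f := fun x => ‖ψ x‖ ^ 2) (fun _ _ => by positivity)
    (Finset.mem_univ x)

/-- If single spin flips over a reference configuration hop with amplitudes of equal modulus, the
chain is gapless. -/
lemma gapless_of_hopping {ψ : Fin 2 × Fin 2 → ℂ} (h : IsUnitState ψ) (hψ : IsEntangled ψ)
    (n : ℕ → Fin 2) (h0 : ∀ i, ψ (n i, n (i + 1)) = 0)
    (h1 : ∀ i, ψ (n i + 1, n (i + 1) + 1) = 0)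
    (hα : ∀ i, ψ (n i + 1, n (i + 1)) ≠ 0) (hβ : ∀ i, ψ (n i, n (i + 1) + 1) ≠ 0)
    (hαβ : ∀ i, ‖ψ (n i, n (i + 1) + 1)‖ = ‖ψ (n (i + 1) + 1, n (i + 2))‖) :
    Gapless (proj ψ) := by
  set α : ℕ → ℂ := fun i => ψ (n i + 1, n (i + 1)) with hαd
  set β : ℕ → ℂ := fun i => ψ (n i, n (i + 1) + 1) with hβd
  -- `D i` prescribes the overlap of the trial vector with the dimer vector on bond `i`. The
  -- recursion makes bonds `i` and `i + 1` cancel at site `i + 1`; equal hopping moduli keep `‖D i‖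
  -- = 1`.
  let D : ℕ → ℂ := fun i => Nat.rec 1 (fun i d => -β i / α (i + 1) * d) i
  -- The amplitudes of the trial vector solve the overlap equations successively; the initial value
  -- is free and taken to be zero.
  let f : ℕ → ℂ := fun i => Nat.rec 0 (fun i c => (D i - star (α i) * c) / star (β i)) i
  have hD (i : ℕ) : D (i + 1) = -β i / α (i + 1) * D i := rfl
  have hf (i : ℕ) : star (α i) * f i + star (β i) * f (i + 1) = D i := by
    have hfi : f (i + 1) = (D i - star (α i) * f i) / star (β i) := rfl
    have hb := star_ne_zero.2 (hβ i)
    rw [hfi, mul_div_cancel₀ _ hb]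
    ring
  have hDn (i : ℕ) : ‖D i‖ = 1 := by
    induction i with
    | zero => exact norm_one
    | succ i ih =>
      rw [hD, norm_mul, norm_div, norm_neg, ih, mul_one]
      have : ‖β i‖ = ‖α (i + 1)‖ := hαβ i
      rw [this]
      exact div_self (norm_ne_zero_iff.2 (hα _))
  have hDrec (i : ℕ) : D i * β i + D (i + 1) * α (i + 1) = 0 := by
    have := hα (i + 1)
    rw [hD]
    change α (i + 1) ≠ 0 at this
    field_simp
    ring
  clear_value D f
  intro ε hε
  -- The trial vector will have `‖Hv‖² ≤ 2` and energy `L - 1`, so `L - 1 > 2 / ε` suffices.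
  obtain ⟨M, hM⟩ := exists_nat_gt (2 / ε)
  refine ⟨M + 2, fun L hL => ?_⟩
  obtain ⟨N, rfl⟩ : ∃ N, L = N + 2 := ⟨L - 2, by omega⟩
  set e := flipVec (N + 2) n with he
  have hee (k l : ℕ) (hk : k < N + 2) : star (e k) ⬝ᵥ e l = if k = l then 1 else 0 := by
    rw [he, flipVec, flipVec, ← Pi.single_star, star_one, single_one_dotProduct, Pi.single_apply]
    split_ifs with h2 h3 h3
    · rfl
    · exact absurd (flipped_injOn hk h2) h3
    · exact absurd (congrArg _ h3) h2
    · rfl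
  set v : (Fin (N + 2) → Fin 2) → ℂ := ∑ k ∈ Finset.range (N + 2), f k • e k with hv
  have hve (i : ℕ) (hi : i < N + 2) : star v ⬝ᵥ e i = star (f i) := by
    rw [hv, star_sum, sum_dotProduct, Finset.sum_eq_single i]
    · rw [star_smul, smul_dotProduct, hee i i hi, if_pos rfl, smul_eq_mul, mul_one]
    · intro k hk hki
      rw [star_smul, smul_dotProduct, hee k i (Finset.mem_range.1 hk), if_neg hki, smul_zero]
    · intro hi'
      exact absurd (Finset.mem_range.2 hi) hi'
  have hbond (i : Fin (N + 2 - 1)) :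
      bond (proj ψ) i *ᵥ v = D i • (α i • e i + β i • e (i + 1)) := by
    rw [hv, mulVec_sum]
    simp only [mulVec_smul, he, bond_mulVec_flipVec h0 h1 i, smul_smul]
    rw [← Finset.sum_smul, ← hf]
    congr 1
    have hi := i.isLt
    simp only [mul_ite, mul_zero]
    rw [Finset.sum_eq_add (i : ℕ) (i + 1 : ℕ) (by omega)]
    · simp [α, β, mul_comm]
    · rintro k - ⟨hk1, hk2⟩
      simp [hk1, hk2]
    · intro hk; exact absurd (Finset.mem_range.2 (by omega)) hk
    · intro hk; exact absurd (Finset.mem_range.2 (by omega)) hk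
  have hH1 : chain (proj ψ) (N + 2) *ᵥ v =
      ∑ i ∈ Finset.range (N + 1), D i • (α i • e i + β i • e (i + 1)) := by
    rw [chain, sum_mulVec, Finset.sum_range]
    exact Finset.sum_congr rfl fun i _ => hbond i
  have hH2 : chain (proj ψ) (N + 2) *ᵥ v = (D 0 * α 0) • e 0 + (D N * β N) • e (N + 1) := by
    rw [hH1, ← sum_range_telescope e (fun i => D i * α i) (fun i => D i * β i) hDrec]
    simp only [smul_add, smul_smul]
  have hE : star v ⬝ᵥ (chain (proj ψ) (N + 2) *ᵥ v) = (N + 1 : ℕ) := by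
    rw [hH1, dotProduct_sum]
    have : ∀ i ∈ Finset.range (N + 1), star v ⬝ᵥ (D i • (α i • e i + β i • e (i + 1))) = 1 := by
      intro i hi
      have hi := Finset.mem_range.1 hi
      rw [dotProduct_smul, dotProduct_add, dotProduct_smul, dotProduct_smul, hve i (by omega),
        hve (i + 1) (by omega)]
      have h2 := congrArg star (hf i)
      simp only [star_add, star_mul', star_star] at h2
      rw [smul_eq_mul, smul_eq_mul, smul_eq_mul, h2, RCLike.star_def, Complex.mul_conj', hDn]
      norm_num
    rw [Finset.sum_congr rfl this]
    simp
  have hV : (star (chain (proj ψ) (N + 2) *ᵥ v) ⬝ᵥ (chain (proj ψ) (N + 2) *ᵥ v)).re ≤ 2 := by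
    have h2 : star (chain (proj ψ) (N + 2) *ᵥ v) ⬝ᵥ (chain (proj ψ) (N + 2) *ᵥ v) =
        ((‖α 0‖ ^ 2 + ‖β N‖ ^ 2 : ℝ) : ℂ) := by
      rw [hH2]
      simp only [star_add, star_smul, add_dotProduct, dotProduct_add, smul_dotProduct,
        dotProduct_smul, hee 0 _ (Nat.succ_pos _), hee (N + 1) _ (Nat.lt_succ_self _), smul_eq_mul,
        star_mul']
      have a0 := Complex.mul_conj' (α 0)
      have a1 := Complex.mul_conj' (β N)
      have d0 := Complex.mul_conj' (D 0)
      have d1 := Complex.mul_conj' (D N)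
      rw [hDn, Complex.ofReal_one, one_pow] at d0 d1
      push_cast
      rw [← a0, ← a1]
      simp only [RCLike.star_def]
      linear_combination (α 0 * (starRingEnd ℂ) (α 0)) * d0 + (β N * (starRingEnd ℂ) (β N)) * d1
    rw [h2, Complex.ofReal_re]
    linarith [h.norm_le_one (n 0 + 1, n (0 + 1)), h.norm_le_one (n N, n (N + 1) + 1)]
  refine exists_gap_lt (chain_posSemidef h _) (isGroundEnergy_chain h hψ (by omega))
    (chain_ne_zero h hψ (by omega)) (v := v) (hV.trans_lt ?_)
  rw [hE, Complex.natCast_re]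
  have hMN : (M : ℝ) ≤ (N + 1 : ℕ) := by exact_mod_cast (by omega : M ≤ N + 1)
  have := (div_lt_iff₀ hε).1 hM
  nlinarith

/-- The reference is the alternating configuration. The two amplitudes whose moduli must agree are
then the same entry of `ψ`, so no relation between `|a|` and `|d|` is required. -/
lemma gapless_of_even {ψ : Fin 2 × Fin 2 → ℂ} (h : IsUnitState ψ) (hψ : IsEntangled ψ)
    (he : ψ ∈ evenSector) : Gapless (proj ψ) := by
  obtain ⟨h0, h1⟩ := mem_evenSector_iff.1 he
  obtain ⟨ha, hd⟩ := hψ.even_ne_zero he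
  let n : ℕ → Fin 2 := fun i => Nat.rec 0 (fun _ x => x + 1) i
  have hn (i : ℕ) : n (i + 1) = n i + 1 := rfl
  refine gapless_of_hopping h hψ n ?_ ?_ ?_ ?_ ?_ <;> intro i <;>
    simp only [hn] <;> generalize n i = x <;> fin_cases x <;> simp [h0, h1, ha, hd]

lemma gapless_of_odd {ψ : Fin 2 × Fin 2 → ℂ} (h : IsUnitState ψ) (hψ : IsEntangled ψ)
    (ho : ψ ∈ oddSector) (heq : ‖ψ (0, 1)‖ = ‖ψ (1, 0)‖) : Gapless (proj ψ) := by
  obtain ⟨h0, h1⟩ := mem_oddSector_iff.1 ho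
  obtain ⟨hb, hc⟩ := hψ.odd_ne_zero ho
  exact gapless_of_hopping h hψ (fun _ => 0) (fun _ => h0) (fun _ => h1) (fun _ => hc)
    (fun _ => hb) (fun _ => heq)

/-! ### Parity -/

lemma pauliZ_kronecker_mul_proj_apply (ψ : Fin 2 × Fin 2 → ℂ) (p q : Fin 2 × Fin 2) :
    ((pauliZ ⊗ₖ pauliZ) * proj ψ) p q =
      pauliZ p.1 p.1 * pauliZ p.2 p.2 * (ψ p * star (ψ q)) := by
  obtain ⟨x, y⟩ := p
  simp only [Matrix.mul_apply, Fintype.sum_prod_type, Fin.sum_univ_two, kronecker_apply, proj,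
    vecMulVec_apply, Pi.star_apply]
  fin_cases x <;> fin_cases y <;> simp [pauliZ]

lemma proj_mul_pauliZ_kronecker_apply (ψ : Fin 2 × Fin 2 → ℂ) (p q : Fin 2 × Fin 2) :
    (proj ψ * (pauliZ ⊗ₖ pauliZ)) p q =
      pauliZ q.1 q.1 * pauliZ q.2 q.2 * (ψ p * star (ψ q)) := by
  obtain ⟨x, y⟩ := q
  simp only [Matrix.mul_apply, Fintype.sum_prod_type, Fin.sum_univ_two, kronecker_apply, proj,
    vecMulVec_apply, Pi.star_apply]
  fin_cases x <;> fin_cases y <;> simp [pauliZ]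

lemma commute_proj_pauliZ {ψ : Fin 2 × Fin 2 → ℂ} (h : ψ ∈ evenSector ∨ ψ ∈ oddSector) :
    Commute (proj ψ) (pauliZ ⊗ₖ pauliZ) := by
  ext p q
  rw [proj_mul_pauliZ_kronecker_apply, pauliZ_kronecker_mul_proj_apply]
  obtain ⟨x, y⟩ := p
  obtain ⟨z, w⟩ := q
  rw [mem_evenSector_iff, mem_oddSector_iff] at h
  rcases h with ⟨h0, h1⟩ | ⟨h0, h1⟩ <;>
    fin_cases x <;> fin_cases y <;> fin_cases z <;> fin_cases w <;> simp [pauliZ, h0, h1]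

lemma commute_chain_parity {h : DimerOp} (hc : Commute h (pauliZ ⊗ₖ pauliZ)) (L : ℕ) :
    Commute (chain h L) (parity L) := by
  refine (Commute.sum_right _ _ _ fun i _ => ?_).symm
  exact tensorOp_mul_dimerAt (fun _ => pauliZ) (bond_sites_ne i) hc.eq.symm

lemma parity_eq_diagonal (L : ℕ) :
    parity L = diagonal fun s => ∏ k, pauliZ (s k) (s k) := by
  ext s t
  rw [parity, tensorOp, of_apply, diagonal_apply]
  split_ifs with h
  · rw [h]
  · obtain ⟨k, hk⟩ := Function.ne_iff.1 h
    refine Finset.prod_eq_zero (Finset.mem_univ k) ?_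
    generalize s k = x at hk
    generalize t k = y at hk
    fin_cases x <;> fin_cases y <;> simp_all [pauliZ]

lemma pauliZ_add_one (x : Fin 2) : pauliZ (x + 1) (x + 1) = -pauliZ x x := by
  fin_cases x <;> simp [pauliZ]

lemma pauliZ_diag_ne_zero (x : Fin 2) : pauliZ x x ≠ 0 := by
  fin_cases x <;> simp [pauliZ]

lemma prod_pauliZ_flip (s : Fin L → Fin 2) (m : Fin L) :
    ∏ k, pauliZ (update s m (s m + 1) k) (update s m (s m + 1) k) =
      -∏ k, pauliZ (s k) (s k) := by
  rw [Fintype.prod_eq_mul_prod_compl m, Fintype.prod_eq_mul_prod_compl m, update_self,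
    pauliZ_add_one, neg_mul]
  congr 2
  refine Finset.prod_congr rfl fun k hk => ?_
  rw [update_of_ne (by simpa using hk)]

/-- A bond containing a site of no other bond detects an amplitude that flips this site alone. -/
lemma not_commute_chain_parity {ψ : Fin 2 × Fin 2 → ℂ} (i : Fin (L - 1)) (m : Fin L)
    (hm : m.val = i ∨ m.val = i + 1)
    (hm' : ∀ j : Fin (L - 1), j ≠ i → m.val ≠ j ∧ m.val ≠ j + 1) (s : Fin L → Fin 2)
    (h1 : ψ (s ⟨i.val, by omega⟩, s ⟨i.val + 1, by omega⟩) ≠ 0)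
    (h2 : ψ (update s m (s m + 1) ⟨i.val, by omega⟩,
      update s m (s m + 1) ⟨i.val + 1, by omega⟩) ≠ 0) :
    ¬ Commute (chain (proj ψ) L) (parity L) := by
  intro hc
  have h3 := congrFun (congrFun hc.eq s) (update s m (s m + 1))
  rw [parity_eq_diagonal, mul_diagonal, diagonal_mul, prod_pauliZ_flip] at h3
  have h4 : chain (proj ψ) L s (update s m (s m + 1)) =
      ψ (s ⟨i.val, by omega⟩, s ⟨i.val + 1, by omega⟩) *
        star (ψ (update s m (s m + 1) ⟨i.val, by omega⟩,
          update s m (s m + 1) ⟨i.val + 1, by omega⟩)) := by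
    rw [chain, Matrix.sum_apply, Finset.sum_eq_single i]
    · simp only [bond, dimerAt, of_apply]
      rw [if_pos]
      · rfl
      · intro k hk hk'
        rw [update_of_ne]
        rintro rfl
        simp only [ne_eq, Fin.ext_iff] at hk hk'
        tauto
    · intro j _ hj
      simp only [bond, dimerAt, of_apply]
      rw [if_neg]
      intro hk
      have := hk m (by simpa [Fin.ext_iff] using (hm' j hj).1)
        (by simpa [Fin.ext_iff] using (hm' j hj).2)
      rw [update_self] at this
      exact fin_two_add_one_ne _ this.symm
    · intro hi; exact absurd (Finset.mem_univ i) hi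
  have h5 : ∏ k, pauliZ (s k) (s k) ≠ 0 :=
    Finset.prod_ne_zero_iff.2 fun k _ => pauliZ_diag_ne_zero _
  have h6 : chain (proj ψ) L s (update s m (s m + 1)) ≠ 0 := by
    rw [h4]; exact mul_ne_zero h1 (star_ne_zero.2 h2)
  -- A single flip negates the parity, so the commutator's entry doubles instead of cancelling.
  have h7 : 2 * (chain (proj ψ) L s (update s m (s m + 1)) * ∏ k, pauliZ (s k) (s k)) = 0 := by
    linear_combination -h3
  simp [h5, h6] at h7

/-- Place the four amplitudes on a square with edges given by single flips. The first and last sites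
of the chain rule out two nonzero amplitudes on an edge, so the support lies on a diagonal. -/
lemma mem_sector_of_commute {ψ : Fin 2 × Fin 2 → ℂ} (hL : 2 ≤ L)
    (hc : Commute (chain (proj ψ) L) (parity L)) : ψ ∈ evenSector ∨ ψ ∈ oddSector := by
  have first (x y : Fin 2) (h1 : ψ (x, y) ≠ 0) : ψ (x + 1, y) = 0 := by
    by_contra h2
    have hne : (⟨1, by omega⟩ : Fin L) ≠ ⟨0, by omega⟩ := by simp
    refine not_commute_chain_parity ⟨0, by omega⟩ ⟨0, by omega⟩ (.inl rfl) ?_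
      (fun k => if k.val = 0 then x else y) ?_ ?_ hc
    · intro j hj
      simp only [ne_eq, Fin.ext_iff] at hj
      simp only
      omega
    · simpa using h1
    · simpa [hne] using h2
  have last (x y : Fin 2) (h1 : ψ (x, y) ≠ 0) : ψ (x, y + 1) = 0 := by
    by_contra h2
    have hne : (⟨L - 2, by omega⟩ : Fin L) ≠ ⟨L - 1, by omega⟩ := by
      simp only [ne_eq, Fin.ext_iff]; omega
    have he : (⟨L - 2 + 1, by omega⟩ : Fin L) = ⟨L - 1, by omega⟩ := by
      simp only [Fin.ext_iff]; omega
    have hn : L - 2 ≠ L - 1 := by omega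
    have hn' : L - 2 + 1 = L - 1 := by omega
    refine not_commute_chain_parity ⟨L - 2, by omega⟩ ⟨L - 1, by omega⟩
      (.inr (by simp only; omega)) ?_
      (fun k => if k.val = L - 1 then y else x) ?_ ?_ hc
    · intro j hj
      have := j.isLt
      simp only [ne_eq, Fin.ext_iff] at hj
      simp only
      omega
    · simpa [hn, hn'] using h1
    · simpa [he, hne, hn] using h2
  rw [mem_evenSector_iff, mem_oddSector_iff]
  by_cases h0 : ψ (0, 0) = 0
  · by_cases h1 : ψ (1, 1) = 0
    · exact .inr ⟨h0, h1⟩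
    · exact .inl ⟨by simpa using first 1 1 h1, by simpa using last 1 1 h1⟩
  · exact .inl ⟨by simpa using last 0 0 h0, by simpa using first 0 0 h0⟩

lemma parity_tfae (ψ : Fin 2 × Fin 2 → ℂ) (hL : 2 ≤ L) :
    List.TFAE [
      Commute (chain (proj ψ) L) (parity L),
      ∀ i : Fin (L - 1), Commute (bond (proj ψ) i : ChainOp L) (bond (pauliZ ⊗ₖ pauliZ) i),
      Commute (proj ψ) (pauliZ ⊗ₖ pauliZ),
      ψ ∈ evenSector ∨ ψ ∈ oddSector] := by
  tfae_have 1 → 4 := mem_sector_of_commute hL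
  tfae_have 4 → 3 := commute_proj_pauliZ
  tfae_have 3 → 1 := fun h => commute_chain_parity h L
  tfae_have 3 → 2 := fun h i => by rw [commute_iff_eq, bond_mul, bond_mul, h.eq]
  tfae_have 2 → 3 := fun h => by
    have h1 := (h ⟨0, by omega⟩).eq
    rw [bond_mul, bond_mul] at h1
    exact dimerAt_injective (bond_sites_ne _) h1
  tfae_finish

/-! ### The one-parameter family -/

lemma psiTheta_apply (θ : ℝ) : psiTheta θ (0, 0) = 0 ∧ psiTheta θ (1, 1) = 0 ∧
    psiTheta θ (0, 1) = Real.cos (θ / 2) ∧ psiTheta θ (1, 0) = Real.sin (θ / 2) := by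
  simp [psiTheta, ket]

lemma psiTheta_isUnitState (θ : ℝ) : IsUnitState (psiTheta θ) := by
  obtain ⟨h0, h1, h2, h3⟩ := psiTheta_apply θ
  simp only [IsUnitState, Fintype.sum_prod_type, Fin.sum_univ_two, h0, h1, h2, h3,
    Complex.norm_real, Real.norm_eq_abs, sq_abs]
  simp

lemma psiTheta_mem_oddSector (θ : ℝ) : psiTheta θ ∈ oddSector :=
  mem_oddSector_iff.2 ⟨(psiTheta_apply θ).1, (psiTheta_apply θ).2.1⟩

lemma cos_half_pos {θ : ℝ} (hθ : θ ∈ Set.Ioo 0 (Real.pi / 2)) : 0 < Real.cos (θ / 2) :=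
  Real.cos_pos_of_mem_Ioo ⟨by linarith [hθ.1, Real.pi_pos], by linarith [hθ.2, Real.pi_pos]⟩

lemma sin_half_pos {θ : ℝ} (hθ : θ ∈ Set.Ioo 0 (Real.pi / 2)) : 0 < Real.sin (θ / 2) :=
  Real.sin_pos_of_pos_of_lt_pi (by linarith [hθ.1]) (by linarith [hθ.2, Real.pi_pos])

lemma isEntangled_of_odd {ψ : Fin 2 × Fin 2 → ℂ} (h0 : ψ (0, 0) = 0) (h2 : ψ (0, 1) ≠ 0)
    (h3 : ψ (1, 0) ≠ 0) : IsEntangled ψ := by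
  rintro ⟨u, v, h⟩
  rw [h] at h0 h2 h3
  rcases mul_eq_zero.1 h0 with h | h <;> simp [h] at h2 h3

lemma psiTheta_isEntangled {θ : ℝ} (hθ : θ ∈ Set.Ioo 0 (Real.pi / 2)) :
    IsEntangled (psiTheta θ) := by
  obtain ⟨h0, h1, h2, h3⟩ := psiTheta_apply θ
  refine isEntangled_of_odd h0 ?_ ?_
  · rw [h2]; exact_mod_cast (cos_half_pos hθ).ne'
  · rw [h3]; exact_mod_cast (sin_half_pos hθ).ne'

lemma proj_psiTheta (θ : ℝ) : proj (psiTheta θ) = (1 / 4 : ℂ) • (1 + hTheta θ) := by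
  obtain ⟨h0, h1, h2, h3⟩ := psiTheta_apply θ
  have e1 : (Real.cos θ : ℂ) = 2 * (Real.cos (θ / 2) : ℂ) ^ 2 - 1 := by
    have := Real.cos_two_mul (θ / 2)
    rw [mul_div_cancel₀ _ (two_ne_zero)] at this
    exact_mod_cast this
  have e2 : (Real.sin θ : ℂ) = 2 * (Real.sin (θ / 2) : ℂ) * (Real.cos (θ / 2) : ℂ) := by
    have := Real.sin_two_mul (θ / 2)
    rw [mul_div_cancel₀ _ (two_ne_zero)] at this
    exact_mod_cast this
  have e3 : (Real.sin (θ / 2) : ℂ) ^ 2 + (Real.cos (θ / 2) : ℂ) ^ 2 = 1 := by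
    exact_mod_cast Real.sin_sq_add_cos_sq (θ / 2)
  ext ⟨x, y⟩ ⟨z, w⟩
  simp only [proj, vecMulVec_apply, Pi.star_apply, hTheta, Matrix.smul_apply, Matrix.add_apply,
    Matrix.sub_apply, kronecker_apply, smul_eq_mul]
  rw [e1, e2]
  generalize (Real.cos (θ / 2)) = c at *
  generalize (Real.sin (θ / 2)) = d at *
  fin_cases x <;> fin_cases y <;> fin_cases z <;> fin_cases w <;>
    simp [h0, h1, h2, h3, pauliX, pauliY, pauliZ, one_apply] <;>
    first | done | ring1 | linear_combination e3

lemma hTheta_eq (θ : ℝ) : hTheta θ = (4 : ℂ) • proj (psiTheta θ) + (-1 : ℂ) • 1 := by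
  rw [proj_psiTheta, smul_smul]
  norm_num

lemma bond_hTheta_eq (θ : ℝ) (i : Fin (L - 1)) :
    bond (hTheta θ) i = ((4 : ℝ) : ℂ) • bond (proj (psiTheta θ)) i + ((-1 : ℝ) : ℂ) • 1 := by
  simp only [bond]
  rw [hTheta_eq, dimerAt_add, dimerAt_smul, dimerAt_smul, dimerAt_one]
  norm_num

lemma bond_proj_psiTheta (θ : ℝ) (i : Fin (L - 1)) :
    bond (proj (psiTheta θ)) i = (1 / 4 : ℂ) • (1 + bond (hTheta θ) i) := by
  rw [bond_hTheta_eq]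
  push_cast
  module

lemma chain_hTheta_eq (θ : ℝ) (hL : 1 ≤ L) :
    chain (hTheta θ) L =
      ((4 : ℝ) : ℂ) • chain (proj (psiTheta θ)) L + ((-((L : ℝ) - 1) : ℝ) : ℂ) • 1 := by
  simp only [chain, bond_hTheta_eq, Finset.sum_add_distrib, ← Finset.smul_sum, Finset.sum_const,
    Finset.card_univ, Fintype.card_fin]
  rw [← Nat.cast_smul_eq_nsmul ℂ, smul_smul]
  push_cast [hL]
  ring_nf

lemma hTheta_gapped {θ : ℝ} (hθ : θ ∈ Set.Ioo 0 (Real.pi / 2)) : Gapped (hTheta θ) := by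
  obtain ⟨-, -, h2, h3⟩ := psiTheta_apply θ
  have hlt : Real.sin (θ / 2) < Real.cos (θ / 2) := by
    rw [← Real.cos_pi_div_two_sub]
    exact Real.cos_lt_cos_of_nonneg_of_le_pi (by linarith [hθ.1]) (by linarith [hθ.1, Real.pi_pos])
      (by linarith [hθ.2])
  obtain ⟨c, hc, hg⟩ := gapped_of_odd (psiTheta_isUnitState θ) (psiTheta_isEntangled hθ)
    (psiTheta_mem_oddSector θ) (by
      rw [h2, h3, Complex.norm_real, Complex.norm_real, Real.norm_of_nonneg (cos_half_pos hθ).le,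
        Real.norm_of_nonneg (sin_half_pos hθ).le]
      exact hlt.ne')
  refine ⟨4 * c, by positivity, fun L hL => ?_⟩
  obtain ⟨γ, hγ, hle⟩ := hg L hL
  exact ⟨4 * γ, hγ.affine four_pos (chain_hTheta_eq θ (by omega)), by linarith⟩

lemma commute_chain_hTheta (θ : ℝ) (hL : 1 ≤ L) : Commute (chain (hTheta θ) L) (parity L) := by
  rw [chain_hTheta_eq θ hL]
  exact ((commute_chain_parity
    (commute_proj_pauliZ (.inr (psiTheta_mem_oddSector θ))) L).smul_left _).add_left
      ((Commute.one_left _).smul_left _)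

lemma isGroundEnergy_hTheta {θ : ℝ} (hθ : θ ∈ Set.Ioo 0 (Real.pi / 2)) (hL : 1 ≤ L) :
    IsGroundEnergy (chain (hTheta θ) L) (-((L : ℝ) - 1)) := by
  have := (isGroundEnergy_chain (psiTheta_isUnitState θ) (psiTheta_isEntangled hθ) hL).affine
    four_pos (chain_hTheta_eq θ hL)
  simpa using this

lemma energySpace_hTheta (θ : ℝ) (hL : 1 ≤ L) :
    energySpace (chain (hTheta θ) L) (-((L : ℝ) - 1)) =
      energySpace (chain (proj (psiTheta θ)) L) 0 := by
  rw [← energySpace_affine four_ne_zero (chain_hTheta_eq θ hL) 0, mul_zero, zero_add]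

lemma hTheta_isFrustrationFree {θ : ℝ} (hθ : θ ∈ Set.Ioo 0 (Real.pi / 2)) (hL : 1 ≤ L) :
    IsFrustrationFree (hTheta θ) L := by
  intro E hE i
  obtain rfl := hE.unique (isGroundEnergy_hTheta hθ hL)
  refine ⟨4 * 0 + -1, (isGroundEnergy_bond (psiTheta_isUnitState θ) (psiTheta_isEntangled hθ)
    i).affine four_pos (bond_hTheta_eq θ i), ?_⟩
  rw [energySpace_hTheta θ hL, energySpace_affine four_ne_zero (bond_hTheta_eq θ i)]
  exact energySpace_chain_le (psiTheta_isUnitState θ) i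

/-! ### Reflection -/

lemma reflection_apply (s t : Fin L → Fin 2) :
    reflection L s t = if s ∘ Fin.rev = t then 1 else 0 := by
  rw [reflection, of_apply]
  congr 1
  refine propext ⟨fun h => funext fun k => ?_, ?_⟩
  · rw [Function.comp_apply, h, Fin.rev_rev]
  · rintro rfl k
    rw [Function.comp_apply, Fin.rev_rev]

lemma reflection_mul (A : ChainOp L) : reflection L * A = A.submatrix (· ∘ Fin.rev) id := by
  ext s t
  simp [Matrix.mul_apply, reflection_apply]

lemma reflection_conj (A : ChainOp L) :
    reflection L * A * (reflection L)ᴴ = A.submatrix (· ∘ Fin.rev) (· ∘ Fin.rev) := by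
  rw [reflection_mul]
  ext s t
  simp [Matrix.mul_apply, reflection_apply]

lemma comp_rev_injective : Injective fun s : Fin L → Fin 2 => s ∘ Fin.rev :=
  Fin.rev_surjective.injective_comp_right

lemma reflection_mem_unitaryGroup : reflection L ∈ unitaryGroup (Fin L → Fin 2) ℂ := by
  rw [mem_unitaryGroup_iff, star_eq_conjTranspose]
  have := reflection_conj (1 : ChainOp L)
  rwa [mul_one, submatrix_one _ comp_rev_injective] at this

lemma reflection_conj_dimerAt (h : DimerOp) (j k : Fin L) :
    reflection L * dimerAt h j k * (reflection L)ᴴ = dimerAt h j.rev k.rev := by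
  rw [reflection_conj]
  ext s t
  simp only [dimerAt, of_apply, submatrix_apply, Function.comp_apply]
  congr 1
  refine propext ⟨fun H m hj hk => ?_, fun H m hj hk => H _ (by simpa using hj) (by simpa using hk)⟩
  have := H m.rev (fun h => hj (by rw [← h, Fin.rev_rev])) (fun h => hk (by rw [← h, Fin.rev_rev]))
  rwa [Fin.rev_rev] at this

lemma reflection_commute_parity : Commute (reflection L) (parity L) := by
  have h1 : reflection L * parity L * (reflection L)ᴴ = parity L := by
    rw [reflection_conj]
    ext s t
    simp only [parity, tensorOp, of_apply, submatrix_apply, Function.comp_apply]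
    exact Equiv.prod_comp Fin.revPerm fun k => pauliZ (s k) (t k)
  have h2 : (reflection L)ᴴ * reflection L = 1 := by
    rw [← star_eq_conjTranspose]
    exact mem_unitaryGroup_iff'.1 reflection_mem_unitaryGroup
  calc reflection L * parity L = reflection L * parity L * (reflection L)ᴴ * reflection L := by
        rw [mul_assoc _ _ (reflection L), h2, mul_one]
    _ = parity L * reflection L := by rw [h1]

/-! ### Reduction of odd states to the family -/

/-- The single-qubit phase gate `diag (1, ω ^ k)`. -/
def phaseGate (ω : ℂ) (k : ℕ) : QubitOp := !![1, 0; 0, ω ^ k]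

lemma phaseGate_mem_unitaryGroup {ω : ℂ} (hω : ‖ω‖ = 1) (k : ℕ) :
    phaseGate ω k ∈ unitaryGroup (Fin 2) ℂ := by
  rw [mem_unitaryGroup_iff, star_eq_conjTranspose]
  have h := Complex.mul_conj' (ω ^ k)
  rw [norm_pow, hω] at h
  ext x y
  fin_cases x <;> fin_cases y <;> simp [phaseGate, Matrix.mul_apply]
  simpa using h

lemma phaseGate_commute_pauliZ (ω : ℂ) (k : ℕ) : Commute (phaseGate ω k) pauliZ := by
  ext x y
  fin_cases x <;> fin_cases y <;> simp [phaseGate, pauliZ, Matrix.mul_apply]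

/-- The relative phase of the two amplitudes of an odd state. -/
def oddPhase (ψ : Fin 2 × Fin 2 → ℂ) : ℂ :=
  ψ (1, 0) * star (ψ (0, 1)) / ((‖ψ (0, 1)‖ : ℂ) * (‖ψ (1, 0)‖ : ℂ))

/-- The odd state with the same moduli and no phases. -/
def oddModulus (ψ : Fin 2 × Fin 2 → ℂ) : Fin 2 × Fin 2 → ℂ :=
  (‖ψ (0, 1)‖ : ℂ) • ket 0 1 + (‖ψ (1, 0)‖ : ℂ) • ket 1 0

lemma norm_oddPhase {ψ : Fin 2 × Fin 2 → ℂ} (hb : ψ (0, 1) ≠ 0) (hc : ψ (1, 0) ≠ 0) :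
    ‖oddPhase ψ‖ = 1 := by
  have := norm_ne_zero_iff.2 hb
  have := norm_ne_zero_iff.2 hc
  simp only [oddPhase, norm_div, norm_mul, norm_star, Complex.norm_real, norm_norm]
  field_simp

/-- The gates give `|01⟩` one more factor of the relative phase than `|10⟩`, which aligns the two
amplitudes. The common phase left over depends on `k` but disappears in the projection. -/
lemma phaseGate_kronecker_mul_proj {ψ : Fin 2 × Fin 2 → ℂ} (h0 : ψ (0, 0) = 0) (h1 : ψ (1, 1) = 0)
    (hb : ψ (0, 1) ≠ 0) (hc : ψ (1, 0) ≠ 0) (k : ℕ) :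
    (phaseGate (oddPhase ψ) k ⊗ₖ phaseGate (oddPhase ψ) (k + 1)) * proj ψ =
      proj (oddModulus ψ) * (phaseGate (oddPhase ψ) k ⊗ₖ phaseGate (oddPhase ψ) (k + 1)) := by
  have nb : (‖ψ (0, 1)‖ : ℂ) ≠ 0 := by exact_mod_cast norm_ne_zero_iff.2 hb
  have nc : (‖ψ (1, 0)‖ : ℂ) ≠ 0 := by exact_mod_cast norm_ne_zero_iff.2 hc
  have b2 := Complex.mul_conj' (ψ (0, 1))
  have c2 := Complex.mul_conj' (ψ (1, 0))
  have e1 : oddPhase ψ * ψ (0, 1) * (starRingEnd ℂ) (ψ (1, 0)) =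
      (‖ψ (0, 1)‖ : ℂ) * (‖ψ (1, 0)‖ : ℂ) := by
    rw [oddPhase, RCLike.star_def]
    field_simp
    rw [← b2, ← c2]
    ring
  have e2 : ψ (1, 0) * (starRingEnd ℂ) (ψ (0, 1)) =
      (‖ψ (0, 1)‖ : ℂ) * (‖ψ (1, 0)‖ : ℂ) * oddPhase ψ := by
    rw [oddPhase, RCLike.star_def]
    field_simp
  ext ⟨x, y⟩ ⟨z, w⟩
  simp only [Matrix.mul_apply, Fintype.sum_prod_type, Fin.sum_univ_two, kronecker_apply, proj,
    vecMulVec_apply, Pi.star_apply]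
  generalize oddPhase ψ = ω at *
  fin_cases x <;> fin_cases y <;> fin_cases z <;> fin_cases w <;>
    simp [phaseGate, oddModulus, ket, h0, h1]
  · linear_combination ω ^ (k + 1) * b2
  · linear_combination ω ^ k * e1
  · linear_combination ω ^ k * e2
  · linear_combination ω ^ k * c2

lemma conj_eq_of_mul_eq {U A B : ChainOp L} (hU : U ∈ unitaryGroup (Fin L → Fin 2) ℂ)
    (h : U * A = B * U) : U * A * Uᴴ = B := by
  rw [h, mul_assoc, ← star_eq_conjTranspose, mem_unitaryGroup_iff.1 hU, mul_one]

lemma bond_oddModulus_eq {ψ : Fin 2 × Fin 2 → ℂ} (h0 : ψ (0, 0) = 0) (h1 : ψ (1, 1) = 0)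
    (hb : ψ (0, 1) ≠ 0) (hc : ψ (1, 0) ≠ 0) (i : Fin (L - 1)) :
    tensorOp (fun k : Fin L => phaseGate (oddPhase ψ) k) * bond (proj ψ) i *
      (tensorOp fun k : Fin L => phaseGate (oddPhase ψ) k)ᴴ = bond (proj (oddModulus ψ)) i :=
  conj_eq_of_mul_eq
    (tensorOp_mem_unitaryGroup fun k => phaseGate_mem_unitaryGroup (norm_oddPhase hb hc) k)
    (tensorOp_mul_dimerAt _ (bond_sites_ne i) (phaseGate_kronecker_mul_proj h0 h1 hb hc i))

lemma exists_theta {p q : ℝ} (hq : 0 < q) (hqp : q < p) (h : p ^ 2 + q ^ 2 = 1) :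
    ∃ θ ∈ Set.Ioo 0 (Real.pi / 2), Real.cos (θ / 2) = p ∧ Real.sin (θ / 2) = q := by
  have hp1 : p < 1 := by nlinarith
  have hcos : Real.cos (2 * Real.arccos p / 2) = p := by
    rw [mul_div_cancel_left₀ _ two_ne_zero, Real.cos_arccos (by linarith) hp1.le]
  have hsin : Real.sin (2 * Real.arccos p / 2) = q := by
    rw [mul_div_cancel_left₀ _ two_ne_zero, Real.sin_arccos, ← h, add_sub_cancel_left,
      Real.sqrt_sq hq.le]
  refine ⟨2 * Real.arccos p, ⟨mul_pos two_pos (Real.arccos_pos.2 hp1), ?_⟩, hcos, hsin⟩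
  -- Since `q < p` and `p² + q² = 1`, `p` exceeds `1/√2`; this is what keeps `θ` below `π / 2`.
  have h4 : Real.cos (Real.pi / 4) < p := by
    rw [Real.cos_pi_div_four]
    have := Real.sq_sqrt (show (0 : ℝ) ≤ 2 by norm_num)
    have := Real.sqrt_nonneg 2
    nlinarith
  have := Real.arccos_lt_arccos (by linarith [Real.neg_one_le_cos (Real.pi / 4)]) h4 hp1.le
  rw [Real.arccos_cos (by positivity) (by linarith [Real.pi_pos])] at this
  linarith

/-- The permutation `e` accommodates the reflection, which reverses the order of the bonds without
changing their sum. -/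
lemma sum_conj_bond {h : DimerOp} {U : ChainOp L} {g : DimerOp} (hL : 1 ≤ L)
    (e : Equiv.Perm (Fin (L - 1)))
    (hU : ∀ i, U * bond h i * Uᴴ = (1 / 4 : ℂ) • (1 + bond g (e i))) :
    U * chain h L * Uᴴ = (1 / 4 : ℂ) • (((L : ℂ) - 1) • (1 : ChainOp L) + chain g L) := by
  rw [chain, Finset.mul_sum, Finset.sum_mul]
  simp only [hU]
  rw [← Finset.smul_sum, Finset.sum_add_distrib, Equiv.sum_comp e fun i => bond g i, chain,
    Finset.sum_const, Finset.card_univ, Fintype.card_fin, ← Nat.cast_smul_eq_nsmul ℂ]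
  push_cast [hL]
  rfl

lemma exists_unitary_odd {ψ : Fin 2 × Fin 2 → ℂ} (h : IsUnitState ψ) (hψ : IsEntangled ψ)
    (ho : ψ ∈ oddSector) (hne : ‖ψ (0, 1)‖ ≠ ‖ψ (1, 0)‖) :
    ∃ θ : ℝ, θ ∈ Set.Ioo 0 (Real.pi / 2) ∧
      Real.cos (θ / 2) = max ‖ψ (0, 1)‖ ‖ψ (1, 0)‖ ∧
      ∀ L : ℕ, 2 ≤ L →
        ∃ (S : Fin L → QubitOp) (U : ChainOp L),
          (∀ k, S k ∈ Matrix.unitaryGroup (Fin 2) ℂ ∧ Commute (S k) pauliZ) ∧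
          U ∈ Matrix.unitaryGroup (Fin L → Fin 2) ℂ ∧
          Commute U (parity L) ∧
          (‖ψ (1, 0)‖ < ‖ψ (0, 1)‖ →
            U = tensorOp S ∧
            ∀ i : Fin (L - 1), U * bond (proj ψ) i * U.conjTranspose =
              (1 / 4 : ℂ) • (1 + bond (hTheta θ) i)) ∧
          (‖ψ (0, 1)‖ < ‖ψ (1, 0)‖ →
            U = reflection L * tensorOp S ∧
            ∀ i : Fin (L - 1), U * bond (proj ψ) i * U.conjTranspose =
              (1 / 4 : ℂ) • (1 + bond (hTheta θ) i.rev)) ∧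
          U * chain (proj ψ) L * U.conjTranspose =
            (1 / 4 : ℂ) • (((L : ℂ) - 1) • (1 : ChainOp L) + chain (hTheta θ) L) := by
  obtain ⟨h0, h1⟩ := mem_oddSector_iff.1 ho
  obtain ⟨hb, hc⟩ := hψ.odd_ne_zero ho
  have hsq := h.odd_norm_sq ho
  have hS (L : ℕ) (k : Fin L) : phaseGate (oddPhase ψ) k ∈ Matrix.unitaryGroup (Fin 2) ℂ ∧
      Commute (phaseGate (oddPhase ψ) k) pauliZ :=
    ⟨phaseGate_mem_unitaryGroup (norm_oddPhase hb hc) k, phaseGate_commute_pauliZ _ _⟩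
  have hV (L : ℕ) := tensorOp_mem_unitaryGroup fun k => (hS L k).1
  have hVp (L : ℕ) : Commute (tensorOp fun k : Fin L => phaseGate (oddPhase ψ) k) (parity L) :=
    tensorOp_commute fun k => (hS L k).2
  rcases hne.lt_or_gt with hlt | hlt
  · obtain ⟨θ, hθ, hcos, hsin⟩ := exists_theta (norm_pos_iff.2 hb) hlt (by rw [add_comm, hsq])
    refine ⟨θ, hθ, by rw [hcos, max_eq_right hlt.le], fun L hL => ?_⟩
    -- Here the larger amplitude sits on `|10⟩`, so the phase-free state is `psiTheta θ` with its
    -- two sites exchanged; the reflection undoes the exchange.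
    have hmod : proj (oddModulus ψ) = (proj (psiTheta θ)).submatrix Prod.swap Prod.swap := by
      ext ⟨x, y⟩ ⟨z, w⟩
      simp only [proj, submatrix_apply, vecMulVec_apply, oddModulus, psiTheta, hcos, hsin]
      fin_cases x <;> fin_cases y <;> fin_cases z <;> fin_cases w <;> simp [ket]
    have key (i : Fin (L - 1)) :
        (reflection L * tensorOp fun k : Fin L => phaseGate (oddPhase ψ) k) * bond (proj ψ) i *
          (reflection L * tensorOp fun k : Fin L => phaseGate (oddPhase ψ) k)ᴴ =
        (1 / 4 : ℂ) • (1 + bond (hTheta θ) i.rev) := by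
      rw [conjTranspose_mul, mul_assoc (reflection L), ← mul_assoc, mul_assoc (reflection L),
        bond_oddModulus_eq h0 h1 hb hc, bond, hmod, dimerAt_swap, reflection_conj_dimerAt,
        ← bond_proj_psiTheta, bond]
      congr 1 <;> simp only [Fin.ext_iff, Fin.val_rev] <;> omega
    refine ⟨fun k => phaseGate (oddPhase ψ) k, _, hS L,
      mul_mem reflection_mem_unitaryGroup (hV L), reflection_commute_parity.mul_left (hVp L),
      fun hgt => absurd hgt hlt.not_gt, fun _ => ⟨rfl, key⟩,
      sum_conj_bond (by omega) Fin.revPerm key⟩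
  · obtain ⟨θ, hθ, hcos, hsin⟩ := exists_theta (norm_pos_iff.2 hc) hlt hsq
    refine ⟨θ, hθ, by rw [hcos, max_eq_left hlt.le], fun L hL => ?_⟩
    have hmod : oddModulus ψ = psiTheta θ := by rw [psiTheta, hcos, hsin, oddModulus]
    have key (i : Fin (L - 1)) :
        (tensorOp fun k : Fin L => phaseGate (oddPhase ψ) k) * bond (proj ψ) i *
          (tensorOp fun k : Fin L => phaseGate (oddPhase ψ) k)ᴴ =
        (1 / 4 : ℂ) • (1 + bond (hTheta θ) i) := by
      rw [bond_oddModulus_eq h0 h1 hb hc, hmod, bond_proj_psiTheta]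
    exact ⟨fun k => phaseGate (oddPhase ψ) k, _, hS L, hV L, hVp L, fun _ => ⟨rfl, key⟩,
      fun hgt => absurd hgt hlt.not_gt, sum_conj_bond (by omega) (Equiv.refl _) key⟩

end QubitChain

end

theorem mainTheorem6 :
    -- parity preservation forces the even or the odd sector
    (∀ ψ : Fin 2 × Fin 2 → ℂ, QubitChain.IsUnitState ψ → ∀ L : ℕ, 2 ≤ L →
      List.TFAE [
        Commute (QubitChain.chain (QubitChain.proj ψ) L) (QubitChain.parity L),
        ∀ i : Fin (L - 1), Commute (QubitChain.bond (QubitChain.proj ψ) i : QubitChain.ChainOp L)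
          (QubitChain.bond (QubitChain.pauliZ ⊗ₖ QubitChain.pauliZ) i),
        Commute (QubitChain.proj ψ) (QubitChain.pauliZ ⊗ₖ QubitChain.pauliZ),
        ψ ∈ QubitChain.evenSector ∨ ψ ∈ QubitChain.oddSector]) ∧
    -- frustration-freeness and the ground space, for entangled states
    (∀ ψ : Fin 2 × Fin 2 → ℂ, QubitChain.IsUnitState ψ → QubitChain.IsEntangled ψ →
      ∀ L : ℕ, 2 ≤ L →
        QubitChain.IsGroundEnergy (QubitChain.chain (QubitChain.proj ψ) L) 0 ∧
        QubitChain.IsFrustrationFree (QubitChain.proj ψ) L ∧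
        Module.finrank ℂ (QubitChain.energySpace (QubitChain.chain (QubitChain.proj ψ) L) 0) =
          L + 1) ∧
    -- the even sector is gapless
    (∀ ψ : Fin 2 × Fin 2 → ℂ, QubitChain.IsUnitState ψ → QubitChain.IsEntangled ψ →
      ψ ∈ QubitChain.evenSector → QubitChain.Gapless (QubitChain.proj ψ)) ∧
    -- the odd sector: gapless for `|b| = |c|`; otherwise gapped, and equivalent to the family
    (∀ ψ : Fin 2 × Fin 2 → ℂ, QubitChain.IsUnitState ψ → QubitChain.IsEntangled ψ →
      ψ ∈ QubitChain.oddSector →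
      (‖ψ (0, 1)‖ = ‖ψ (1, 0)‖ → QubitChain.Gapless (QubitChain.proj ψ)) ∧
      (‖ψ (0, 1)‖ ≠ ‖ψ (1, 0)‖ →
        QubitChain.Gapped (QubitChain.proj ψ) ∧
        ∃ θ : ℝ, θ ∈ Set.Ioo 0 (Real.pi / 2) ∧
          Real.cos (θ / 2) = max ‖ψ (0, 1)‖ ‖ψ (1, 0)‖ ∧
          ∀ L : ℕ, 2 ≤ L →
            ∃ (S : Fin L → QubitChain.QubitOp) (U : QubitChain.ChainOp L),
              (∀ k, S k ∈ Matrix.unitaryGroup (Fin 2) ℂ ∧ Commute (S k) QubitChain.pauliZ) ∧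
              U ∈ Matrix.unitaryGroup (Fin L → Fin 2) ℂ ∧
              Commute U (QubitChain.parity L) ∧
              (‖ψ (1, 0)‖ < ‖ψ (0, 1)‖ →
                U = QubitChain.tensorOp S ∧
                ∀ i : Fin (L - 1),
                  U * QubitChain.bond (QubitChain.proj ψ) i * U.conjTranspose =
                    (1 / 4 : ℂ) • (1 + QubitChain.bond (QubitChain.hTheta θ) i)) ∧
              (‖ψ (0, 1)‖ < ‖ψ (1, 0)‖ →
                U = QubitChain.reflection L * QubitChain.tensorOp S ∧
                ∀ i : Fin (L - 1),
                  U * QubitChain.bond (QubitChain.proj ψ) i * U.conjTranspose =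
                    (1 / 4 : ℂ) • (1 + QubitChain.bond (QubitChain.hTheta θ) i.rev)) ∧
              U * QubitChain.chain (QubitChain.proj ψ) L * U.conjTranspose =
                (1 / 4 : ℂ) • (((L : ℂ) - 1) • (1 : QubitChain.ChainOp L) +
                  QubitChain.chain (QubitChain.hTheta θ) L))) ∧
    -- every member of the family occurs, is gapped, and has an (L+1)-dimensional ground space
    (∀ θ : ℝ, θ ∈ Set.Ioo 0 (Real.pi / 2) →
      QubitChain.IsUnitState (QubitChain.psiTheta θ) ∧
      QubitChain.IsEntangled (QubitChain.psiTheta θ) ∧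
      QubitChain.psiTheta θ ∈ QubitChain.oddSector ∧
      QubitChain.proj (QubitChain.psiTheta θ) = (1 / 4 : ℂ) • (1 + QubitChain.hTheta θ) ∧
      QubitChain.Gapped (QubitChain.hTheta θ) ∧
      ∀ L : ℕ, 2 ≤ L →
        Commute (QubitChain.chain (QubitChain.hTheta θ) L) (QubitChain.parity L) ∧
        QubitChain.IsGroundEnergy (QubitChain.chain (QubitChain.hTheta θ) L) (-((L : ℝ) - 1)) ∧
        QubitChain.IsFrustrationFree (QubitChain.hTheta θ) L ∧
        Module.finrank ℂ (QubitChain.energySpace (QubitChain.chain (QubitChain.hTheta θ) L)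
          (-((L : ℝ) - 1))) = L + 1) := by
  refine ⟨fun ψ _ L hL => QubitChain.parity_tfae ψ hL,
    fun ψ h hψ L hL => ⟨QubitChain.isGroundEnergy_chain h hψ (by omega),
      QubitChain.isFrustrationFree h hψ (by omega),
      QubitChain.finrank_energySpace_chain h hψ (by omega)⟩,
    fun ψ h hψ he => QubitChain.gapless_of_even h hψ he,
    fun ψ h hψ ho => ⟨QubitChain.gapless_of_odd h hψ ho, fun hne =>
      ⟨QubitChain.gapped_of_odd h hψ ho hne, QubitChain.exists_unitary_odd h hψ ho hne⟩⟩,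
    fun θ hθ => ⟨QubitChain.psiTheta_isUnitState θ, QubitChain.psiTheta_isEntangled hθ,
      QubitChain.psiTheta_mem_oddSector θ, QubitChain.proj_psiTheta θ,
      QubitChain.hTheta_gapped hθ, fun L hL =>
        ⟨QubitChain.commute_chain_hTheta θ (by omega),
          QubitChain.isGroundEnergy_hTheta hθ (by omega),
          QubitChain.hTheta_isFrustrationFree hθ (by omega), ?_⟩⟩⟩
  rw [QubitChain.energySpace_hTheta θ (by omega)]
  exact QubitChain.finrank_energySpace_chain (QubitChain.psiTheta_isUnitState θ)
    (QubitChain.psiTheta_isEntangled hθ) (by omega)
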